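/- Let $d\ge 3$ and let $\mathcal S\subset\mathbb P^3_{\mathbb C}$ be a smooth surface of degree $d$. For a line $C\subset\mathcal S$ and a plane $H\supset C$ write $H\cap\mathcal S=C\cup\Gamma_H$, where $\Gamma_H$ is the residual plane curve of degree $d-1$ (the quotient of the equation of $H\cap\mathcal S$ in $H$ by the equation of $C$). Call a point $p\in\Gamma_H$ an inflection of $\Gamma_H$ if some line of $H$ through $p$ meets $\Gamma_H$ at $p$ with intersection multiplicity at least $3$ (a line contained in $\Gamma_H$ is allowed; in particular, singular points of $\Gamma_H$ are inflections). The line $C$ is said to be of the second kind if for every plane $H\supset C$ every point of $C\cap\Gamma_H$ is an inflection of $\Gamma_H$. Assume that $\mathcal S$ contains $d$ distinct coplanar lines, none of which is of the second kind. Then $\mathcal S$ contains only finitely many lines, and their number is at most $d(7d-12)$. -/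

import Mathlib

/-!  Lines on smooth surfaces in complex projective 3-space.

Points of `ℙ³` are represented by nonzero vectors of `ℂ⁴ = (Fin 4 → ℂ)`, lines and planes of `ℙ³`
by the linear subspaces of `ℂ⁴` of dimension 2 and 3. -/

namespace SurfaceLines

/-- The surface `f = 0` in `ℙ³` is smooth: at no point of it all partial derivatives of `f`
vanish. -/
def IsSmooth (f : MvPolynomial (Fin 4) ℂ) : Prop :=
  ∀ v : Fin 4 → ℂ, v ≠ 0 → MvPolynomial.eval v f = 0 →
    ∃ i, MvPolynomial.eval v (MvPolynomial.pderiv i f) ≠ 0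

/-- The set of lines of `ℙ³` contained in the surface `f = 0`. -/
def linesOn (f : MvPolynomial (Fin 4) ℂ) : Set (Submodule ℂ (Fin 4 → ℂ)) :=
  {L | Module.finrank ℂ L = 2 ∧ ∀ v ∈ L, MvPolynomial.eval v f = 0}

/-- `b = (b₀, b₁, b₂)` is a frame of a plane through the line `C`, such that `C` is spanned by
`b₀, b₁`. In the homogeneous coordinates `[x₀ : x₁ : x₂] ↦ x₀ b₀ + x₁ b₁ + x₂ b₂` on the plane
`H = span (b₀, b₁, b₂)`, the line `C` is `x₂ = 0`. Every plane through `C` has such frames. -/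
def IsAdaptedFrame (C : Submodule ℂ (Fin 4 → ℂ)) (b : Fin 3 → Fin 4 → ℂ) : Prop :=
  LinearIndependent ℂ b ∧ Submodule.span ℂ {b 0, b 1} = C

/-- The ternary form `f (x₀ b₀ + x₁ b₁ + x₂ b₂)`, an equation of the section of the surface
`f = 0` by the plane with frame `b`. -/
noncomputable def planeSection (f : MvPolynomial (Fin 4) ℂ) (b : Fin 3 → Fin 4 → ℂ) :
    MvPolynomial (Fin 3) ℂ :=
  MvPolynomial.aeval (fun i => ∑ j, MvPolynomial.C (b j i) * MvPolynomial.X j) f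

/-- An equation of the residual curve `Γ`, where `H ∩ S = C ∪ Γ`: the quotient of the plane section
by the equation `x₂` of `C` (see `planeSection_eq_X_mul_residual`). -/
noncomputable def residual (f : MvPolynomial (Fin 4) ℂ) (b : Fin 3 → Fin 4 → ℂ) :
    MvPolynomial (Fin 3) ℂ :=
  (planeSection f b).divMonomial (Finsupp.single 2 1)

/-- The point `p` of the plane curve `g = 0` is an inflection of that curve: some line `pq` of the
plane meets the curve at `p` with intersection multiplicity at least 3 (possibly infinite, if the
line is a component). At a nonsingular point of the curve such a line is necessarily the tangent,
and a singular point always qualifies. For curves of degree at least 2 these are exactly the points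
of the curve where its Hessian vanishes. -/
def IsInflection (g : MvPolynomial (Fin 3) ℂ) (p : Fin 3 → ℂ) : Prop :=
  MvPolynomial.eval p g = 0 ∧ ∃ q : Fin 3 → ℂ, LinearIndependent ℂ ![p, q] ∧
    (Polynomial.X : Polynomial ℂ) ^ 3 ∣
      MvPolynomial.aeval (fun i => Polynomial.C (p i) + Polynomial.C (q i) * Polynomial.X) g

/-- The line `C` on the surface `f = 0` is of the second kind: for every plane through `C`, all
the points in which `C` meets the residual curve are inflections of the residual curve. -/
def IsSecondKind (f : MvPolynomial (Fin 4) ℂ) (C : Submodule ℂ (Fin 4 → ℂ)) : Prop :=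
  ∀ b : Fin 3 → Fin 4 → ℂ, IsAdaptedFrame C b →
    ∀ p : Fin 3 → ℂ, p ≠ 0 → p 2 = 0 → MvPolynomial.eval p (residual f b) = 0 →
      IsInflection (residual f b) p

theorem eval_planeSection (f : MvPolynomial (Fin 4) ℂ) (b : Fin 3 → Fin 4 → ℂ) (x : Fin 3 → ℂ) :
    MvPolynomial.eval x (planeSection f b) = MvPolynomial.eval (∑ j, x j • b j) f := by
  unfold planeSection
  rw [MvPolynomial.aeval_def, MvPolynomial.algebraMap_eq, MvPolynomial.eval_eval₂]
  have h : (MvPolynomial.eval x).comp MvPolynomial.C = RingHom.id ℂ := by ext; simp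
  rw [h, MvPolynomial.eval₂_id]
  congr 2
  ext i
  simp [Finset.sum_apply, mul_comm]

/-- If `C` lies on the surface, then its equation `x₂` divides the plane section, and the quotient
is `residual f b`. -/
theorem planeSection_eq_X_mul_residual (f : MvPolynomial (Fin 4) ℂ)
    (C : Submodule ℂ (Fin 4 → ℂ)) (hC : C ∈ linesOn f) (b : Fin 3 → Fin 4 → ℂ)
    (hb : IsAdaptedFrame C b) : planeSection f b = MvPolynomial.X 2 * residual f b := by
  set P := planeSection f b with hP
  have hdec := MvPolynomial.divMonomial_add_modMonomial_single P (2 : Fin 3)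
  suffices h : P.modMonomial (Finsupp.single 2 1) = 0 by
    rw [h, add_zero] at hdec
    exact hdec.symm
  apply MvPolynomial.funext
  intro x
  have key : MvPolynomial.eval (Function.update x 2 0) P = 0 := by
    rw [hP, eval_planeSection]
    apply hC.2
    rw [← hb.2, Fin.sum_univ_three]
    simp only [Function.update_self, zero_smul, add_zero]
    exact Submodule.add_mem _
      (Submodule.smul_mem _ _ (Submodule.subset_span (by simp)))
      (Submodule.smul_mem _ _ (Submodule.subset_span (by simp)))
  rw [← hdec] at key
  simp only [map_add, map_mul, MvPolynomial.eval_X, Function.update_self, zero_mul,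
    zero_add] at key
  rw [map_zero, ← key, MvPolynomial.eval_eq, MvPolynomial.eval_eq]
  refine Finset.sum_congr rfl fun m hm => ?_
  have hm2 : m 2 = 0 := by
    by_contra hne
    refine (MvPolynomial.mem_support_iff.mp hm) (MvPolynomial.coeff_modMonomial_of_le P ?_)
    rw [Finsupp.single_le_iff]
    omega
  congr 1
  refine Finset.prod_congr rfl fun i _ => ?_
  by_cases hi : i = 2
  · subst hi; simp [hm2]
  · simp [Function.update_of_ne hi]

end SurfaceLines

/-!
The plane section of the surface by `H` has degree `d`, so it is the union of the `d` lines of `T`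
(`exists_mem_of_mem_plane`). A line of the surface outside `T` meets `H` in a point of this union,
hence meets some `C ∈ T`. By Segre's bound (`card_le_of_meets`) at most `8 d - 14` lines meet `C`,
among them the `d - 1` other lines of `T`, which leaves at most `d + d (7 d - 13) = d (7 d - 12)`
lines.

For Segre's bound take coordinates with `C` given by `x₂ = x₃ = 0`, and write the equation as
`F = α x₂ + β x₃ + …` with forms `α, β` in `x₀, x₁` of degree `d - 1`. Smoothness says that `α` and
`β` have no common zero, so the tangent plane at the point `(1 : t : 0 : 0)` is
`(x₂ : x₃) = (-β(t) : α(t))`. The residual curve in this plane passes through the point; that it has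
an inflection there is the vanishing of a differential expression in its coefficients (`flexForm`).
With `(-β : α)` inserted, this expression is a polynomial `flexPoly` in `t`. Three facts about it
give the bound.

* Its degree is at most `8 d - 14`, because by Euler's identity the leading terms cancel
  (`natDegree_flexPoly_le`).
* It is nonzero if `C` is not of the second kind (`exists_coord_flexPoly_ne_zero`).
* If `m` further lines of the surface pass through the point `(1 : t : 0 : 0)`, they lie in its
  tangent plane, the residual curve has multiplicity at least `m` there, and `t` is a zero of
  `flexPoly` of multiplicity at least `m` (`X_sub_C_pow_dvd_flexPoly`).

Finitely many lines being given, the coordinates can be chosen so that none of them passes through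
the point `(0 : 1 : 0 : 0)`, and everything takes place in polynomials in one variable.
-/

namespace SurfaceLines

open Polynomial

/-! ### The flex polynomial of a line -/

/-- For a quaternary form `F = ∑ F_{jk}(x₀, x₁) x₂ʲ x₃ᵏ`, the dehomogenized coefficient
`F_{jk}(1, X)`. -/
noncomputable def slice (F : MvPolynomial (Fin 4) ℂ) (j k : ℕ) : ℂ[X] :=
  ∑ m ∈ F.support, if m 2 = j ∧ m 3 = k then monomial (m 1) (F.coeff m) else 0

/-- Write `k_i = ∑_{j+k=i} F_{jk}(1, X) lʲ mᵏ`, so that `F(1, X, l s, m s) = k₀ + k₁ s + k₂ s² + …`.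
This is `2 k₃ k₁'² - 2 k₁' k₂ k₂' + k₂² k₁''`, where `'` differentiates the `F_{jk}` only. If
`k₀ = k₁ = 0` at a point, it vanishes there if and only if the curve `k₁ + k₂ s + k₃ s² + … = 0`,
residual to the line `s = 0` in the plane `(x₂ : x₃) = (l : m)`, has an inflection there: it is the
second derivative of the curve along its tangent vector `(k₂, -k₁')`. -/
noncomputable def flexForm (F : MvPolynomial (Fin 4) ℂ) (l m : ℂ[X]) : ℂ[X] :=
  2 * (l ^ 3 * slice F 3 0 + l ^ 2 * m * slice F 2 1 + l * m ^ 2 * slice F 1 2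
      + m ^ 3 * slice F 0 3)
    * (l * derivative (slice F 1 0) + m * derivative (slice F 0 1)) ^ 2
  - 2 * (l * derivative (slice F 1 0) + m * derivative (slice F 0 1))
    * (l ^ 2 * slice F 2 0 + l * m * slice F 1 1 + m ^ 2 * slice F 0 2)
    * (l ^ 2 * derivative (slice F 2 0) + l * m * derivative (slice F 1 1)
      + m ^ 2 * derivative (slice F 0 2))
  + (l ^ 2 * slice F 2 0 + l * m * slice F 1 1 + m ^ 2 * slice F 0 2) ^ 2
    * (l * derivative (derivative (slice F 1 0)) + m * derivative (derivative (slice F 0 1)))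

/-- The flex polynomial of the line `x₂ = x₃ = 0` on the surface `F = 0`: its value at `t` tests
whether the point `(1 : t : 0 : 0)` is an inflection of the curve residual to the line in the
tangent plane of the surface at that point. -/
noncomputable def flexPoly (F : MvPolynomial (Fin 4) ℂ) : ℂ[X] :=
  flexForm F (-slice F 0 1) (slice F 1 0)

theorem natDegree_slice_le {F : MvPolynomial (Fin 4) ℂ} {d : ℕ} (hF : F.IsHomogeneous d)
    (j k : ℕ) : (slice F j k).natDegree ≤ d - j - k := by
  refine natDegree_sum_le_of_forall_le _ _ fun m hm => ?_
  split_ifs with h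
  · refine (natDegree_monomial_le _).trans ?_
    have := hF (MvPolynomial.mem_support_iff.mp hm)
    rw [Finsupp.weight_apply, Finsupp.sum_fintype _ _ (by simp), Fin.sum_univ_four] at this
    simp at this
    omega
  · simp

theorem natDegree_X_mul_derivative_sub_le (u : ℂ[X]) (N : ℕ) (hu : u.natDegree ≤ N) :
    (X * derivative u - (N : ℂ[X]) * u).natDegree ≤ N - 1 := by
  rw [natDegree_le_iff_coeff_eq_zero]
  intro i hi
  have hi' : N ≤ i := by omega
  rw [coeff_sub, ← C_eq_natCast, coeff_C_mul]
  rcases i with _ | i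
  · obtain rfl : N = 0 := by omega
    simp
  · rw [coeff_X_mul, coeff_derivative]
    rcases hi'.eq_or_lt with h | h
    · rw [h]; push_cast; ring
    · rw [coeff_eq_zero_of_natDegree_lt (hu.trans_lt h)]; simp

theorem natDegree_le_of_X_mul {u : ℂ[X]} {N : ℕ} (h : (X * u).natDegree ≤ N + 1) :
    u.natDegree ≤ N := by
  by_cases hu : u = 0
  · simp [hu]
  · rw [natDegree_X_mul hu] at h; omega

/-- The degree is smaller by 2 than the degrees of the forms `F_{jk}` suggest. For `u` of degree at
most `N` the degree of `X u' - N u` is at most `N - 1`; inserting `X u' = N u + …`, the leading terms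
cancel once in the Wronskian of `F₁₀, F₀₁` and once more in the whole expression. -/
theorem natDegree_flexPoly_le {F : MvPolynomial (Fin 4) ℂ} {d : ℕ} (hd : 3 ≤ d)
    (hF : F.IsHomogeneous d) : (flexPoly F).natDegree ≤ 8 * d - 14 := by
  obtain ⟨k, rfl⟩ := Nat.exists_eq_add_of_le' hd
  set a := slice F 1 0 with ha
  set b := slice F 0 1 with hb
  have hda : a.natDegree ≤ k + 2 := natDegree_slice_le hF 1 0
  have hdb : b.natDegree ≤ k + 2 := natDegree_slice_le hF 0 1
  have h20 : (slice F 2 0).natDegree ≤ k + 1 := natDegree_slice_le hF 2 0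
  have h11 : (slice F 1 1).natDegree ≤ k + 1 := natDegree_slice_le hF 1 1
  have h02 : (slice F 0 2).natDegree ≤ k + 1 := natDegree_slice_le hF 0 2
  have h30 : (slice F 3 0).natDegree ≤ k := natDegree_slice_le hF 3 0
  have h21 : (slice F 2 1).natDegree ≤ k := natDegree_slice_le hF 2 1
  have h12 : (slice F 1 2).natDegree ≤ k := natDegree_slice_le hF 1 2
  have h03 : (slice F 0 3).natDegree ≤ k := natDegree_slice_le hF 0 3
  have hnb : (-b).natDegree ≤ k + 2 := by rwa [natDegree_neg]
  -- the Wronskian of `a` and `b`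
  set W := -b * derivative a + a * derivative b with hW
  set q := (-b) ^ 2 * slice F 2 0 + -b * a * slice F 1 1 + a ^ 2 * slice F 0 2 with hq
  set q' := (-b) ^ 2 * derivative (slice F 2 0) + -b * a * derivative (slice F 1 1)
      + a ^ 2 * derivative (slice F 0 2) with hq'
  set c := (-b) ^ 3 * slice F 3 0 + (-b) ^ 2 * a * slice F 2 1 + -b * a ^ 2 * slice F 1 2
      + a ^ 3 * slice F 0 3 with hc
  have hΦ : flexPoly F = 2 * c * W ^ 2 - 2 * W * q * q' + q ^ 2 * derivative W := by
    rw [flexPoly, flexForm, hW, hc, hq, hq']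
    simp only [derivative_add, derivative_mul, derivative_neg, ← ha, ← hb]
    ring
  have hdc : c.natDegree ≤ 4 * k + 6 := by
    rw [hc]
    refine natDegree_add_le_of_degree_le (natDegree_add_le_of_degree_le
      (natDegree_add_le_of_degree_le ?_ ?_) ?_) ?_
    · exact (natDegree_mul_le_of_le (natDegree_pow_le_of_le 3 hnb) h30).trans (by omega)
    · exact (natDegree_mul_le_of_le (natDegree_mul_le_of_le (natDegree_pow_le_of_le 2 hnb) hda)
        h21).trans (by omega)
    · exact (natDegree_mul_le_of_le (natDegree_mul_le_of_le hnb (natDegree_pow_le_of_le 2 hda))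
        h12).trans (by omega)
    · exact (natDegree_mul_le_of_le (natDegree_pow_le_of_le 3 hda) h03).trans (by omega)
  have hdW : W.natDegree ≤ 2 * k + 2 := by
    refine natDegree_le_of_X_mul ?_
    have h : X * W = a * (X * derivative b - ((k + 2 : ℕ) : ℂ[X]) * b)
        - b * (X * derivative a - ((k + 2 : ℕ) : ℂ[X]) * a) := by rw [hW]; ring
    rw [h]
    refine (natDegree_sub_le _ _).trans (max_le ?_ ?_)
    · exact (natDegree_mul_le_of_le hda (natDegree_X_mul_derivative_sub_le b _ hdb)).trans (by omega)
    · exact (natDegree_mul_le_of_le hdb (natDegree_X_mul_derivative_sub_le a _ hda)).trans (by omega)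
  have hdq : q.natDegree ≤ 3 * k + 5 := by
    rw [hq]
    refine natDegree_add_le_of_degree_le (natDegree_add_le_of_degree_le ?_ ?_) ?_
    · exact (natDegree_mul_le_of_le (natDegree_pow_le_of_le 2 hnb) h20).trans (by omega)
    · exact (natDegree_mul_le_of_le (natDegree_mul_le_of_le hnb hda) h11).trans (by omega)
    · exact (natDegree_mul_le_of_le (natDegree_pow_le_of_le 2 hda) h02).trans (by omega)
  have hde₁ := natDegree_X_mul_derivative_sub_le W _ hdW
  set e₁ := X * derivative W - ((2 * k + 2 : ℕ) : ℂ[X]) * W with he₁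
  have hE : ∀ u : ℂ[X], u.natDegree ≤ k + 1 →
      (X * derivative u - ((k + 1 : ℕ) : ℂ[X]) * u).natDegree ≤ k :=
    fun u hu => natDegree_X_mul_derivative_sub_le u _ hu
  set e₂ := X * q' - ((k + 1 : ℕ) : ℂ[X]) * q with he₂
  have hde₂ : e₂.natDegree ≤ 3 * k + 4 := by
    have h : e₂ = (-b) ^ 2 * (X * derivative (slice F 2 0) - ((k + 1 : ℕ) : ℂ[X]) * slice F 2 0)
        + -b * a * (X * derivative (slice F 1 1) - ((k + 1 : ℕ) : ℂ[X]) * slice F 1 1)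
        + a ^ 2 * (X * derivative (slice F 0 2) - ((k + 1 : ℕ) : ℂ[X]) * slice F 0 2) := by
      rw [he₂, hq, hq']; ring
    rw [h]
    refine natDegree_add_le_of_degree_le (natDegree_add_le_of_degree_le ?_ ?_) ?_
    · exact (natDegree_mul_le_of_le (natDegree_pow_le_of_le 2 hnb) (hE _ h20)).trans (by omega)
    · exact (natDegree_mul_le_of_le (natDegree_mul_le_of_le hnb hda) (hE _ h11)).trans (by omega)
    · exact (natDegree_mul_le_of_le (natDegree_pow_le_of_le 2 hda) (hE _ h02)).trans (by omega)
  have h2 : (2 : ℂ[X]).natDegree ≤ 0 := (natDegree_ofNat 2).le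
  have hX : (X : ℂ[X]).natDegree ≤ 1 := natDegree_X_le
  -- in `X Φ` the terms `-2 (k + 1) W q ^ 2` and `(2 k + 2) W q ^ 2` cancel
  have hXΦ : X * flexPoly F = 2 * (X * c) * W ^ 2 - 2 * W * q * e₂ + q ^ 2 * e₁ := by
    rw [hΦ, he₁, he₂]; push_cast; ring
  refine natDegree_le_of_X_mul ?_
  rw [hXΦ]
  refine natDegree_add_le_of_degree_le ((natDegree_sub_le _ _).trans (max_le ?_ ?_)) ?_
  · exact (natDegree_mul_le_of_le (natDegree_mul_le_of_le h2 (natDegree_mul_le_of_le hX hdc))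
      (natDegree_pow_le_of_le 2 hdW)).trans (by omega)
  · exact (natDegree_mul_le_of_le (natDegree_mul_le_of_le (natDegree_mul_le_of_le h2 hdW) hdq)
      hde₂).trans (by omega)
  · exact (natDegree_mul_le_of_le (natDegree_pow_le_of_le 2 hdq) hde₁).trans (by omega)

/-! ### Jets along a line -/

/-- The expansion of `F(1, X, l Y, m Y)` in powers of `Y`, the outer variable: the section of the
surface `F = 0` by the plane `(x₂ : x₃) = (l : m)`. -/
noncomputable def planeJet (F : MvPolynomial (Fin 4) ℂ) (l m : ℂ) : ℂ[X][X] :=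
  MvPolynomial.aeval ![1, C X, C (C l) * X, C (C m) * X] F

theorem coeff_planeJet (F : MvPolynomial (Fin 4) ℂ) (l m : ℂ) (n : ℕ) :
    (planeJet F l m).coeff n =
      ∑ p ∈ Finset.HasAntidiagonal.antidiagonal n, C l ^ p.1 * C m ^ p.2 * slice F p.1 p.2 := by
  simp only [planeJet, slice, MvPolynomial.aeval_def, MvPolynomial.eval₂_eq', Finset.mul_sum,
    finsetSum_coeff]
  rw [Finset.sum_comm]
  refine Finset.sum_congr rfl fun s _ => ?_
  have h : (algebraMap ℂ ℂ[X][X]) (F.coeff s)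
      * ∏ i, (![1, C X, C (C l) * X, C (C m) * X] : Fin 4 → ℂ[X][X]) i ^ s i
      = C (C l ^ s 2 * C m ^ s 3 * monomial (s 1) (F.coeff s)) * X ^ (s 2 + s 3) := by
    rw [Fin.prod_univ_four, ← C_mul_X_pow_eq_monomial]
    simp [Polynomial.algebraMap_apply]
    ring
  rw [h, coeff_C_mul_X_pow]
  simp only [mul_ite, mul_zero]
  rw [← Finset.sum_filter]
  split_ifs with hn
  · rw [Finset.sum_eq_single_of_mem (s 2, s 3) (by simp [hn])]
    rintro ⟨i, j⟩ hp hne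
    obtain ⟨_, rfl, rfl⟩ := Finset.mem_filter.1 hp
    exact absurd rfl hne
  · rw [Finset.sum_eq_zero]
    simp only [Finset.mem_filter, Finset.HasAntidiagonal.mem_antidiagonal, Prod.forall]
    rintro i j ⟨h, rfl, rfl⟩
    exact absurd h.symm hn

/-- The substitution `X ↦ u s`, `Y ↦ v s` in a bivariate polynomial. -/
theorem coeff_eval₂_line (K : ℂ[X][X]) (u v : ℂ) (N : ℕ) :
    (K.eval₂ (aeval (C u * X) : ℂ[X] →ₐ[ℂ] ℂ[X]).toRingHom (C v * X)).coeff N =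
      ∑ p ∈ Finset.HasAntidiagonal.antidiagonal N, (K.coeff p.2).coeff p.1 * u ^ p.1 * v ^ p.2 := by
  induction K using Polynomial.induction_on' with
  | add p q hp hq =>
    rw [eval₂_add, coeff_add, hp, hq, ← Finset.sum_add_distrib]
    refine Finset.sum_congr rfl fun s _ => ?_
    simp only [coeff_add]; ring
  | monomial j k =>
    induction k using Polynomial.induction_on' with
    | add p q hp hq =>
      rw [map_add, eval₂_add, coeff_add, hp, hq, ← Finset.sum_add_distrib]
      refine Finset.sum_congr rfl fun s _ => ?_
      simp only [coeff_add]; ring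
    | monomial i c =>
      have h : (monomial j (monomial i c)).eval₂ (aeval (C u * X) : ℂ[X] →ₐ[ℂ] ℂ[X]).toRingHom
          (C v * X) = C (c * u ^ i * v ^ j) * X ^ (i + j) := by
        simp [eval₂_monomial, aeval_monomial]; ring
      rw [h, coeff_C_mul_X_pow]
      simp only [coeff_monomial]
      split_ifs with hn
      · subst hn
        rw [Finset.sum_eq_single_of_mem (i, j) (by simp)]
        · simp
        · rintro ⟨a, b⟩ _ hab
          by_cases hb : j = b
          · subst hb
            have : ¬ i = a := fun h => hab (by rw [h])
            simp [coeff_monomial, this]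
          · simp [hb]
      · rw [Finset.sum_eq_zero]
        rintro ⟨a, b⟩ hab
        rw [Finset.HasAntidiagonal.mem_antidiagonal] at hab
        by_cases hb : j = b
        · have : ¬ i = a := by rintro rfl; subst hb; exact hn hab.symm
          simp [hb, coeff_monomial, this]
        · simp [hb]

theorem planeJet_line (F : MvPolynomial (Fin 4) ℂ) (l m t u v : ℂ) :
    ((planeJet F l m).map (taylorAlgHom t).toRingHom).eval₂
      (aeval (C u * X) : ℂ[X] →ₐ[ℂ] ℂ[X]).toRingHom (C v * X) =
    MvPolynomial.aeval ![1, C t + C u * X, C (l * v) * X, C (m * v) * X] F := by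
  rw [eval₂_map]
  have h : ((eval₂RingHom ((aeval (C u * X) : ℂ[X] →ₐ[ℂ] ℂ[X]).toRingHom.comp
        (taylorAlgHom t).toRingHom) (C v * X)).comp
      (MvPolynomial.aeval ![1, C X, C (C l) * X, C (C m) * X] :
        MvPolynomial (Fin 4) ℂ →ₐ[ℂ] ℂ[X][X]).toRingHom) =
      (MvPolynomial.aeval ![1, C t + C u * X, C (l * v) * X, C (m * v) * X] :
        MvPolynomial (Fin 4) ℂ →ₐ[ℂ] ℂ[X]).toRingHom := by
    apply MvPolynomial.ringHom_ext
    · intro r; simp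
    · intro i
      fin_cases i
      · simp
      · simp [add_comm]
      · simp; ring
      · simp; ring
  exact DFunLike.congr_fun h F

/-- The Taylor expansion of `F` along the line `s ↦ (1, t + u s, l s, m s)`. -/
theorem coeff_aeval_line (F : MvPolynomial (Fin 4) ℂ) (l m t u : ℂ) (N : ℕ) :
    (MvPolynomial.aeval ![1, C t + C u * X, C l * X, C m * X] F : ℂ[X]).coeff N =
      ∑ p ∈ Finset.HasAntidiagonal.antidiagonal N,
        (taylor t ((planeJet F l m).coeff p.2)).coeff p.1 * u ^ p.1 := by
  have h := planeJet_line F l m t u 1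
  rw [mul_one, mul_one] at h
  rw [← h, coeff_eval₂_line]
  simp

theorem eval_aeval_line (F : MvPolynomial (Fin 4) ℂ) (l m t u s : ℂ) :
    (MvPolynomial.aeval ![1, C t + C u * X, C l * X, C m * X] F : ℂ[X]).eval s =
      MvPolynomial.eval ![1, t + u * s, l * s, m * s] F := by
  have h : ((evalRingHom s).comp (MvPolynomial.aeval ![1, C t + C u * X, C l * X, C m * X] :
        MvPolynomial (Fin 4) ℂ →ₐ[ℂ] ℂ[X]).toRingHom) =
      MvPolynomial.eval ![1, t + u * s, l * s, m * s] := by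
    apply MvPolynomial.ringHom_ext
    · intro r; simp
    · intro i
      fin_cases i <;> simp
  exact DFunLike.congr_fun h F

theorem coeff_one_aeval_line (F : MvPolynomial (Fin 4) ℂ) (hF : slice F 0 0 = 0) (l m t u : ℂ) :
    (MvPolynomial.aeval ![1, C t + C u * X, C l * X, C m * X] F : ℂ[X]).coeff 1 =
      l * (slice F 1 0).eval t + m * (slice F 0 1).eval t := by
  rw [coeff_aeval_line, Finset.Nat.antidiagonal_succ]
  simp [coeff_planeJet, Finset.Nat.antidiagonal_succ, hF]
  ring

theorem slice_zero_zero {F : MvPolynomial (Fin 4) ℂ}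
    (hF : ∀ x y : ℂ, MvPolynomial.eval ![x, y, 0, 0] F = 0) : slice F 0 0 = 0 := by
  refine Polynomial.funext fun t => ?_
  have h := coeff_aeval_line F 0 0 t 0 0
  rw [coeff_zero_eq_eval_zero, eval_aeval_line] at h
  simpa [coeff_planeJet, hF] using h.symm

/-- The chain rule for a derivation of the target ring. -/
theorem derivation_aeval {σ A : Type*} [Fintype σ] [CommRing A] [Algebra ℂ A]
    (D : Derivation ℂ A A) (x : σ → A) (F : MvPolynomial σ ℂ) :
    D (MvPolynomial.aeval x F) =
      ∑ i, MvPolynomial.aeval x (MvPolynomial.pderiv i F) * D (x i) := by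
  classical
  induction F using MvPolynomial.induction_on with
  | C a => simp
  | add p q hp hq => simp [hp, hq, add_mul, Finset.sum_add_distrib]
  | mul_X p j hp =>
    have h : ∀ i, MvPolynomial.aeval x (MvPolynomial.pderiv i (p * MvPolynomial.X j)) * D (x i) =
        (if i = j then MvPolynomial.aeval x p * D (x i) else 0)
          + x j * (MvPolynomial.aeval x (MvPolynomial.pderiv i p) * D (x i)) := by
      intro i
      rw [Derivation.leibniz, MvPolynomial.pderiv_X]
      by_cases hij : i = j
      · subst hij; simp; ring
      · simp [hij]; ring
    simp only [h, Finset.sum_add_distrib, ← Finset.mul_sum, ← hp]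
    simp

/-- A smooth surface through the line `x₂ = x₃ = 0` has a tangent plane at each point of it. -/
theorem slice_ne_zero_of_isSmooth {F : MvPolynomial (Fin 4) ℂ} (hs : IsSmooth F)
    (hF : ∀ x y : ℂ, MvPolynomial.eval ![x, y, 0, 0] F = 0) (t : ℂ) :
    (slice F 1 0).eval t ≠ 0 ∨ (slice F 0 1).eval t ≠ 0 := by
  by_contra! h
  obtain ⟨i, hi⟩ := hs ![1, t, 0, 0] (fun h => by simpa using congrFun h 0) (hF 1 t)
  have key : ∀ x : Fin 4 → ℂ[X], (MvPolynomial.aeval x F : ℂ[X]).coeff 1 = 0 →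
      (fun i => (x i).eval 0) = ![1, t, 0, 0] →
      ∑ i, MvPolynomial.eval ![1, t, 0, 0] (MvPolynomial.pderiv i F)
        * (derivative (x i)).eval 0 = 0 := by
    intro x hx h0
    have h1 := congrArg (eval 0) (derivation_aeval derivative' x F)
    rw [derivative'_apply, ← coeff_zero_eq_eval_zero, coeff_derivative, hx, eval_finsetSum] at h1
    simp only [zero_mul, eval_mul] at h1
    refine (Finset.sum_congr rfl fun i _ => ?_).trans h1.symm
    congr 1
    have h : (evalRingHom 0).comp (MvPolynomial.aeval x :
        MvPolynomial (Fin 4) ℂ →ₐ[ℂ] ℂ[X]).toRingHom = MvPolynomial.eval ![1, t, 0, 0] := by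
      rw [← h0]
      apply MvPolynomial.ringHom_ext <;> intro <;> simp
    exact (DFunLike.congr_fun h _).symm
  apply hi
  have k2 : ∀ l m u : ℂ, _ := fun l m u => key ![1, C t + C u * X, C l * X, C m * X]
    (by rw [coeff_one_aeval_line F (slice_zero_zero hF), h.1, h.2]; simp)
    (by ext i; fin_cases i <;> simp)
  have k1 := key ![1 + X, C t, 0, 0]
    (by
      have : (MvPolynomial.aeval ![1 + X, C t, 0, 0] F : ℂ[X]) = 0 := by
        refine Polynomial.funext fun s => ?_
        have h : (evalRingHom s).comp (MvPolynomial.aeval ![1 + X, C t, 0, 0] :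
            MvPolynomial (Fin 4) ℂ →ₐ[ℂ] ℂ[X]).toRingHom = MvPolynomial.eval ![1 + s, t, 0, 0] := by
          apply MvPolynomial.ringHom_ext
          · intro; simp
          · intro i; fin_cases i <;> simp
        exact (DFunLike.congr_fun h F).trans ((hF _ _).trans eval_zero.symm)
      rw [this, coeff_zero])
    (by ext i; fin_cases i <;> simp)
  have a1 := k2 0 0 1
  have a2 := k2 1 0 0
  have a3 := k2 0 1 0
  simp [Fin.sum_univ_four] at k1 a1 a2 a3
  fin_cases i
  · simpa using k1
  · simpa using a1
  · simpa using a2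
  · simpa using a3

/-! ### Vanishing of the flex polynomial at points on several lines -/

/-- If the curve `K(y, s) = 0` contains the lines `s = 0` and `y = c s` for `m` values of `c`, then
`K` has order greater than `m` at the origin. -/
theorem coeff_eq_zero_of_lines {K : ℂ[X][X]} (h0 : K.coeff 0 = 0) {Z : Finset ℂ}
    (h : ∀ c ∈ Z, ∀ N, ∑ p ∈ Finset.HasAntidiagonal.antidiagonal N,
      (K.coeff p.2).coeff p.1 * c ^ p.1 = 0) {a j : ℕ} (haj : a + j ≤ Z.card) :
    (K.coeff j).coeff a = 0 := by
  rcases Nat.eq_zero_or_pos j with rfl | hj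
  · simp [h0]
  -- the part of degree `a + j` of `K`, at `s = 1`
  let P : ℂ[X] := ∑ i ∈ Finset.range (a + j), monomial i ((K.coeff (a + j - i)).coeff i)
  have hP : P = 0 := by
    refine eq_zero_of_degree_lt_of_eval_finset_eq_zero Z (lt_of_lt_of_le ?_ (Nat.cast_le.2 haj)) ?_
    · rw [degree_lt_iff_coeff_zero]
      intro i hi
      simp only [P, finsetSum_coeff, coeff_monomial]
      exact Finset.sum_eq_zero fun k hk => if_neg (by have := Finset.mem_range.1 hk; omega)
    · intro c hc
      have := h c hc (a + j)
      rw [Finset.Nat.sum_antidiagonal_eq_sum_range_succ_mk, Finset.sum_range_succ] at this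
      simpa [P, eval_finsetSum, h0] using this
  have := congrArg (coeff · a) hP
  simpa [P, finsetSum_coeff, coeff_monomial, hj] using this

/-- Write `K = ∑ k_j(y) sʲ` and `m = Z.card`. The orders of `k₁'`, `k₂` are at least `m - 1`, those of
`k₁''`, `k₂'`, `k₃` at least `m - 2`, so each term has order at least `3 m - 4`, which is at least
`m` for `m ≥ 2`. For `m = 1` a separate computation is needed. -/
theorem X_pow_card_dvd_of_lines {K : ℂ[X][X]} (h0 : K.coeff 0 = 0) {Z : Finset ℂ}
    (h : ∀ c ∈ Z, ∀ N, ∑ p ∈ Finset.HasAntidiagonal.antidiagonal N,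
      (K.coeff p.2).coeff p.1 * c ^ p.1 = 0) :
    X ^ Z.card ∣ 2 * K.coeff 3 * derivative (K.coeff 1) ^ 2
      - 2 * derivative (K.coeff 1) * K.coeff 2 * derivative (K.coeff 2)
      + K.coeff 2 ^ 2 * derivative (derivative (K.coeff 1)) := by
  have hc : ∀ a j, a + j ≤ Z.card → (K.coeff j).coeff a = 0 :=
    fun a j => coeff_eq_zero_of_lines h0 h
  obtain hm | hm | ⟨m, hm⟩ : Z.card = 0 ∨ Z.card = 1 ∨ ∃ m, Z.card = m + 2 := by
    rcases hZ : Z.card with _ | _ | m <;> simp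
  · simp [hm]
  · obtain ⟨c, hZ⟩ := Finset.card_eq_one.1 hm
    have h2 := h c (by simp [hZ]) 2
    have h3 := h c (by simp [hZ]) 3
    simp only [Finset.Nat.antidiagonal_succ, Finset.HasAntidiagonal.antidiagonal_zero] at h2 h3
    simp [h0] at h2 h3
    rw [hm, pow_one, X_dvd_iff, coeff_zero_eq_eval_zero]
    simp only [eval_add, eval_sub, eval_mul, eval_pow, ← coeff_zero_eq_eval_zero,
      coeff_derivative, coeff_ofNat_zero]
    set x := (K.coeff 1).coeff 1
    set y := (K.coeff 2).coeff 0
    set z := (K.coeff 2).coeff 1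
    set w := (K.coeff 1).coeff 2
    -- `h2` gives `y = -c x`, which turns the goal into `2 x ^ 2` times `h3`
    linear_combination 2 * x ^ 2 * h3 + (-2 * x * z + 2 * w * (y - c * x)) * h2
  · have d1 : X ^ (m + 1) ∣ derivative (K.coeff 1) := by
      rw [X_pow_dvd_iff]; intro i hi
      rw [coeff_derivative, hc _ _ (by omega), zero_mul]
    have d1' : X ^ m ∣ derivative (derivative (K.coeff 1)) := by
      rw [X_pow_dvd_iff]; intro i hi
      rw [coeff_derivative, coeff_derivative, hc _ _ (by omega), zero_mul, zero_mul]
    have d2 : X ^ (m + 1) ∣ K.coeff 2 := by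
      rw [X_pow_dvd_iff]; intro i hi
      exact hc _ _ (by omega)
    have d2' : X ^ m ∣ derivative (K.coeff 2) := by
      rw [X_pow_dvd_iff]; intro i hi
      rw [coeff_derivative, hc _ _ (by omega), zero_mul]
    have e : ∀ i : ℕ, m + 2 ≤ i → ∀ u : ℂ[X], X ^ i ∣ u → X ^ Z.card ∣ u := fun i hi u hu =>
      (pow_dvd_pow X (by omega)).trans hu
    refine dvd_add (dvd_sub ?_ ?_) ?_
    · refine e ((m + 1) * 2) (by omega) _ (Dvd.dvd.mul_left ?_ _)
      rw [pow_mul]; exact pow_dvd_pow_of_dvd d1 2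
    · refine e (m + 1 + (m + 1) + m) (by omega) _ ?_
      rw [pow_add, pow_add]
      exact mul_dvd_mul (mul_dvd_mul (d1.mul_left 2) d2) d2'
    · refine e ((m + 1) * 2 + m) (by omega) _ ?_
      rw [pow_add, pow_mul]
      exact mul_dvd_mul (pow_dvd_pow_of_dvd d2 2) d1'

theorem X_sub_C_pow_dvd_iff_taylor (t : ℂ) (m : ℕ) (u : ℂ[X]) :
    (X - C t) ^ m ∣ u ↔ X ^ m ∣ taylor t u := by
  have h := map_dvd_iff (taylorEquiv t) (a := (X - C t) ^ m) (b := u)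
  have e : taylorEquiv t ((X - C t) ^ m) = X ^ m := by
    rw [map_pow, map_sub]
    change (taylor t X - taylor t (C t)) ^ m = X ^ m
    rw [taylor_X, taylor_C, add_sub_cancel_right]
  rw [e] at h
  exact h.symm

theorem derivative_taylorAlgHom (t : ℂ) (u : ℂ[X]) :
    derivative (taylorAlgHom t u) = taylorAlgHom t (derivative u) := by
  simp [taylor_apply, derivative_comp]

theorem X_sub_C_pow_dvd_flexForm {F : MvPolynomial (Fin 4) ℂ} (h0 : slice F 0 0 = 0) {t l m : ℂ}
    {Z : Finset ℂ}
    (hZ : ∀ c ∈ Z, ∀ s, MvPolynomial.eval ![1, t + c * s, l * s, m * s] F = 0) :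
    (X - C t) ^ Z.card ∣ flexForm F (C l) (C m) ∧
      (X - C t) ^ Z.card ∣ C l * slice F 1 0 + C m * slice F 0 1 := by
  set K : ℂ[X][X] := (planeJet F l m).map (taylorAlgHom t).toRingHom with hK
  have hKc : ∀ j, K.coeff j = taylor t ((planeJet F l m).coeff j) := fun j => by
    simp [hK]
  have hK0 : K.coeff 0 = 0 := by
    rw [hKc, coeff_planeJet]; simp [h0]
  have hlines : ∀ c ∈ Z, ∀ N, ∑ p ∈ Finset.HasAntidiagonal.antidiagonal N,
      (K.coeff p.2).coeff p.1 * c ^ p.1 = 0 := by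
    intro c hc N
    simp only [hKc]
    rw [← coeff_aeval_line]
    have : (MvPolynomial.aeval ![1, C t + C c * X, C l * X, C m * X] F : ℂ[X]) = 0 :=
      Polynomial.funext fun s => by rw [eval_aeval_line, hZ c hc, eval_zero]
    rw [this, coeff_zero]
  have hJ1 : (planeJet F l m).coeff 1 = C l * slice F 1 0 + C m * slice F 0 1 := by
    rw [coeff_planeJet]; simp [Finset.Nat.antidiagonal_succ]; ring
  constructor
  · set J := planeJet F l m with hJ
    have key : flexForm F (C l) (C m) = 2 * J.coeff 3 * derivative (J.coeff 1) ^ 2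
        - 2 * derivative (J.coeff 1) * J.coeff 2 * derivative (J.coeff 2)
        + J.coeff 2 ^ 2 * derivative (derivative (J.coeff 1)) := by
      rw [hJ1, hJ]
      simp [coeff_planeJet, Finset.Nat.antidiagonal_succ, flexForm, derivative_pow]
      ring
    have hKT : ∀ j, taylorAlgHom t (J.coeff j) = K.coeff j := fun j => (hKc j).symm
    rw [X_sub_C_pow_dvd_iff_taylor, key]
    change X ^ Z.card ∣ taylorAlgHom t _
    simp only [map_add, map_sub, map_mul, map_pow, map_ofNat, ← derivative_taylorAlgHom, hKT]
    exact X_pow_card_dvd_of_lines hK0 hlines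
  · rw [X_sub_C_pow_dvd_iff_taylor, ← hJ1, ← hKc, X_pow_dvd_iff]
    intro i hi
    exact coeff_eq_zero_of_lines hK0 hlines (by omega)

theorem flexForm_mul (F : MvPolynomial (Fin 4) ℂ) (r l m : ℂ[X]) :
    flexForm F (r * l) (r * m) = r ^ 5 * flexForm F l m := by
  unfold flexForm; ring

theorem dvd_flexForm_sub (F : MvPolynomial (Fin 4) ℂ) {D l m l' m' : ℂ[X]} (hl : D ∣ l - l')
    (hm : D ∣ m - m') : D ∣ flexForm F l m - flexForm F l' m' := by
  rw [← Ideal.mem_span_singleton, ← Ideal.Quotient.eq] at *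
  simp only [flexForm, map_add, map_sub, map_mul, map_pow, hl, hm]

/-- A point of the line `x₂ = x₃ = 0` through which `Z.card` further lines of the surface pass is a
zero of the flex polynomial of at least that multiplicity. -/
theorem X_sub_C_pow_dvd_flexPoly {F : MvPolynomial (Fin 4) ℂ} (h0 : slice F 0 0 = 0) {t : ℂ}
    (ht : (slice F 1 0).eval t ≠ 0 ∨ (slice F 0 1).eval t ≠ 0) {Z : Finset ℂ}
    (hZ : ∀ c ∈ Z, ∀ s, MvPolynomial.eval
      ![1, t + c * s, -(slice F 0 1).eval t * s, (slice F 1 0).eval t * s] F = 0) :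
    (X - C t) ^ Z.card ∣ flexPoly F := by
  obtain ⟨h1, h2⟩ := X_sub_C_pow_dvd_flexForm h0 hZ
  set a := (slice F 1 0).eval t
  set b := (slice F 0 1).eval t
  -- modulo `(X - t) ^ Z.card` the tangent plane is constant
  obtain ⟨r, hr1, hr2⟩ : ∃ r : ℂ[X], (X - C t) ^ Z.card ∣ -slice F 0 1 - r * C (-b) ∧
      (X - C t) ^ Z.card ∣ slice F 1 0 - r * C a := by
    rcases ht with ha | hb
    · have hC : C a⁻¹ * C a = 1 := by rw [← C_mul, inv_mul_cancel₀ ha, C_1]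
      refine ⟨C a⁻¹ * slice F 1 0, ?_, ?_⟩
      · have e : -slice F 0 1 - C a⁻¹ * slice F 1 0 * C (-b) =
            -C a⁻¹ * (C (-b) * slice F 1 0 + C a * slice F 0 1) := by
          linear_combination (slice F 0 1) * hC
        rw [e]; exact h2.mul_left _
      · have e : slice F 1 0 - C a⁻¹ * slice F 1 0 * C a = 0 := by
          linear_combination (-slice F 1 0) * hC
        rw [e]; exact dvd_zero _
    · have hC : C b⁻¹ * C b = 1 := by rw [← C_mul, inv_mul_cancel₀ hb, C_1]
      refine ⟨C b⁻¹ * slice F 0 1, ?_, ?_⟩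
      · have e : -slice F 0 1 - C b⁻¹ * slice F 0 1 * C (-b) = 0 := by
          rw [C_neg]; linear_combination (slice F 0 1) * hC
        rw [e]; exact dvd_zero _
      · have e : slice F 1 0 - C b⁻¹ * slice F 0 1 * C a =
            -C b⁻¹ * (C (-b) * slice F 1 0 + C a * slice F 0 1) := by
          rw [C_neg]; linear_combination (-slice F 1 0) * hC
        rw [e]; exact h2.mul_left _
  have h3 := dvd_flexForm_sub F hr1 hr2
  rw [flexForm_mul] at h3
  have := dvd_add h3 (h1.mul_left (r ^ 5))
  rwa [sub_add_cancel] at this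

/-! ### Lines of the second kind -/

theorem exists_binary_quadratic_zero (a b c : ℂ) :
    ∃ u v : ℂ, (u ≠ 0 ∨ v ≠ 0) ∧ a * u ^ 2 + b * u * v + c * v ^ 2 = 0 := by
  by_cases ha : a = 0
  · exact ⟨1, 0, by simp, by simp [ha]⟩
  · obtain ⟨s, hs⟩ := IsAlgClosed.exists_pow_nat_eq (b ^ 2 - 4 * a * c) (n := 2) (by norm_num)
    refine ⟨(-b + s) / (2 * a), 1, by simp, ?_⟩
    field_simp
    linear_combination hs

/-- If the flex polynomial vanishes at `t = 0` and the plane `x₃ = 0` is tangent at the point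
`(1 : 0 : 0 : 0)`, then this point is an inflection of the residual curve in this plane. -/
theorem isInflection_of_eval_flexPoly {F : MvPolynomial (Fin 4) ℂ}
    (ht : (slice F 1 0).eval 0 ≠ 0 ∨ (slice F 0 1).eval 0 ≠ 0) {g : MvPolynomial (Fin 3) ℂ}
    (hg : MvPolynomial.aeval ![MvPolynomial.X 0, MvPolynomial.X 1, MvPolynomial.X 2, 0] F =
      MvPolynomial.X 2 * g)
    (hg0 : MvPolynomial.eval ![1, 0, 0] g = 0) (hF : (flexPoly F).eval 0 = 0) :
    IsInflection g ![1, 0, 0] := by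
  set G : ℂ[X][X] := MvPolynomial.aeval ![1, C X, X] g with hG
  have hGc : ∀ j, G.coeff j = slice F (j + 1) 0 := by
    intro j
    have h1 : X * G = planeJet F 1 0 := by
      have h := congrArg (MvPolynomial.aeval (R := ℂ) ![1, C X, (X : ℂ[X][X])]) hg
      rw [map_mul, MvPolynomial.aeval_X, ← hG] at h
      have e : (MvPolynomial.aeval ![1, C X, X] : MvPolynomial (Fin 3) ℂ →ₐ[ℂ] ℂ[X][X]).comp
          (MvPolynomial.aeval ![MvPolynomial.X 0, MvPolynomial.X 1, MvPolynomial.X 2, 0] :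
            MvPolynomial (Fin 4) ℂ →ₐ[ℂ] MvPolynomial (Fin 3) ℂ) =
          (MvPolynomial.aeval ![1, C X, C (C 1) * X, C (C 0) * X] :
            MvPolynomial (Fin 4) ℂ →ₐ[ℂ] ℂ[X][X]) := by
        apply MvPolynomial.algHom_ext
        intro i; fin_cases i <;> simp
      exact h.symm.trans (DFunLike.congr_fun e F)
    rw [← coeff_X_mul, h1, coeff_planeJet, Finset.sum_eq_single_of_mem (j + 1, 0) (by simp)]
    · simp
    · rintro ⟨a, b⟩ hab hne
      have : b ≠ 0 := by rintro rfl; simp at hab; exact hne (by rw [hab])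
      simp [this]
  have hline : ∀ u v : ℂ, ∀ N, (MvPolynomial.aeval
      (fun i => C ((![1, 0, 0] : Fin 3 → ℂ) i) + C ((![0, u, v] : Fin 3 → ℂ) i) * X) g :
        ℂ[X]).coeff N =
      ∑ p ∈ Finset.HasAntidiagonal.antidiagonal N,
        (slice F (p.2 + 1) 0).coeff p.1 * u ^ p.1 * v ^ p.2 := by
    intro u v N
    simp only [← hGc]
    rw [← coeff_eval₂_line, hG]
    have e : (eval₂RingHom (aeval (C u * X) : ℂ[X] →ₐ[ℂ] ℂ[X]).toRingHom (C v * X)).comp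
        (MvPolynomial.aeval ![1, C X, X] : MvPolynomial (Fin 3) ℂ →ₐ[ℂ] ℂ[X][X]).toRingHom =
        (MvPolynomial.aeval
          (fun i => C ((![1, 0, 0] : Fin 3 → ℂ) i) + C ((![0, u, v] : Fin 3 → ℂ) i) * X) :
          MvPolynomial (Fin 3) ℂ →ₐ[ℂ] ℂ[X]).toRingHom := by
      apply MvPolynomial.ringHom_ext
      · intro; simp
      · intro i; fin_cases i <;> simp
    exact congrArg (coeff · N) (DFunLike.congr_fun e g).symm
  have ha0 : (slice F 1 0).coeff 0 = 0 := by
    have h := hline 0 0 0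
    rw [coeff_zero_eq_eval_zero] at h
    have e : (evalRingHom 0).comp (MvPolynomial.aeval
          (fun i => C ((![1, 0, 0] : Fin 3 → ℂ) i) + C ((![0, 0, 0] : Fin 3 → ℂ) i) * X) :
          MvPolynomial (Fin 3) ℂ →ₐ[ℂ] ℂ[X]).toRingHom = MvPolynomial.eval ![1, 0, 0] := by
      apply MvPolynomial.ringHom_ext <;> intro <;> simp
    have e' := DFunLike.congr_fun e g
    rw [hg0] at e'
    have := e'.symm.trans h
    simpa using this.symm
  -- it remains to find a tangent direction along which the second derivative vanishes
  suffices h : ∃ u v : ℂ, (u ≠ 0 ∨ v ≠ 0) ∧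
      (slice F 1 0).coeff 1 * u + (slice F 2 0).coeff 0 * v = 0 ∧
      (slice F 1 0).coeff 2 * u ^ 2 + (slice F 2 0).coeff 1 * u * v
        + (slice F 3 0).coeff 0 * v ^ 2 = 0 by
    obtain ⟨u, v, huv, h1, h2⟩ := h
    refine ⟨hg0, ![0, u, v], ?_, ?_⟩
    · rw [LinearIndependent.pair_iff]
      intro a b hab
      have e0 := congrFun hab 0
      have e1 := congrFun hab 1
      have e2 := congrFun hab 2
      simp at e0 e1 e2
      refine ⟨e0, ?_⟩
      rcases huv with h | h
      · exact e1.resolve_right h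
      · exact e2.resolve_right h
    · rw [X_pow_dvd_iff]
      intro N hN
      rw [hline]
      interval_cases N
      · simp [ha0]
      · simp [Finset.Nat.antidiagonal_succ]
        linear_combination h1
      · simp [Finset.Nat.antidiagonal_succ]
        linear_combination h2
  by_cases hz : (slice F 1 0).coeff 1 = 0 ∧ (slice F 2 0).coeff 0 = 0
  · obtain ⟨u, v, huv, h⟩ := exists_binary_quadratic_zero ((slice F 1 0).coeff 2)
      ((slice F 2 0).coeff 1) ((slice F 3 0).coeff 0)
    exact ⟨u, v, huv, by rw [hz.1, hz.2]; ring, h⟩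
  · -- at a nonsingular point take the tangent vector; up to the factor `-2 F₀₁(0) ^ 5`, the value of
    -- the flex polynomial is the second Taylor coefficient along it
    refine ⟨(slice F 2 0).coeff 0, -(slice F 1 0).coeff 1, ?_, by ring, ?_⟩
    · rw [neg_ne_zero]
      by_contra! h
      exact hz ⟨h.2, h.1⟩
    · have hb : (slice F 0 1).coeff 0 ≠ 0 := by
        rw [← coeff_zero_eq_eval_zero, ← coeff_zero_eq_eval_zero] at ht
        exact ht.resolve_left (not_not.2 ha0)
      simp only [flexPoly, flexForm, eval_add, eval_sub, eval_mul, eval_pow, eval_neg,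
        ← coeff_zero_eq_eval_zero, coeff_derivative, ha0, coeff_ofNat_zero] at hF
      have h5 : (-(slice F 0 1).coeff 0) ^ 5 * (2 * ((slice F 1 0).coeff 2
          * (slice F 2 0).coeff 0 ^ 2 + (slice F 2 0).coeff 1 * (slice F 2 0).coeff 0
            * -(slice F 1 0).coeff 1 + (slice F 3 0).coeff 0 * (-(slice F 1 0).coeff 1) ^ 2)) =
          0 := by
        rw [← hF]; push_cast; ring
      simpa [hb] using h5

/-- The form `f` in the coordinates of a basis `b` of `ℂ⁴`. -/
noncomputable def coordForm (f : MvPolynomial (Fin 4) ℂ) (b : Fin 4 → Fin 4 → ℂ) :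
    MvPolynomial (Fin 4) ℂ :=
  MvPolynomial.aeval (fun i => ∑ j, MvPolynomial.C (b j i) * MvPolynomial.X j) f

theorem eval_coordForm (f : MvPolynomial (Fin 4) ℂ) (b : Fin 4 → Fin 4 → ℂ) (x : Fin 4 → ℂ) :
    MvPolynomial.eval x (coordForm f b) = MvPolynomial.eval (∑ j, x j • b j) f := by
  have e : (MvPolynomial.eval x).comp (MvPolynomial.aeval
      (fun i => ∑ j, MvPolynomial.C (b j i) * MvPolynomial.X j) :
        MvPolynomial (Fin 4) ℂ →ₐ[ℂ] MvPolynomial (Fin 4) ℂ).toRingHom =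
      MvPolynomial.eval (∑ j, x j • b j) := by
    apply MvPolynomial.ringHom_ext
    · intro; simp
    · intro; simp [mul_comm]
  exact DFunLike.congr_fun e f

theorem isHomogeneous_coordForm {f : MvPolynomial (Fin 4) ℂ} {d : ℕ} (hf : f.IsHomogeneous d)
    (b : Fin 4 → Fin 4 → ℂ) : (coordForm f b).IsHomogeneous d := by
  have := hf.aeval (n := 1) (fun i => ∑ j, MvPolynomial.C (b j i) * MvPolynomial.X j)
    (fun i => MvPolynomial.IsHomogeneous.sum _ _ _ fun j _ =>
      MvPolynomial.isHomogeneous_C_mul_X _ _)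
  rwa [one_mul] at this

theorem isSmooth_coordForm {f : MvPolynomial (Fin 4) ℂ} (hf : IsSmooth f)
    {b : Fin 4 → Fin 4 → ℂ} (hb : LinearIndependent ℂ b) : IsSmooth (coordForm f b) := by
  intro v hv hv0
  by_contra! h
  rw [eval_coordForm] at hv0
  have hne : ∑ j, v j • b j ≠ 0 := fun h0 =>
    hv (funext (Fintype.linearIndependent_iff.1 hb v h0))
  obtain ⟨i, hi⟩ := hf _ hne hv0
  have hc : ∀ j, ∑ i, MvPolynomial.eval (∑ j, v j • b j) (MvPolynomial.pderiv i f) * b j i = 0 := by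
    intro j
    rw [← h j, coordForm, derivation_aeval (MvPolynomial.pderiv j), map_sum]
    refine Finset.sum_congr rfl fun i _ => ?_
    rw [map_mul]
    congr 1
    · exact (eval_coordForm _ b v).symm
    · simp [MvPolynomial.pderiv_X, Pi.single_apply]
  have hspan : ∀ w : Fin 4 → ℂ,
      ∑ i, MvPolynomial.eval (∑ j, v j • b j) (MvPolynomial.pderiv i f) * w i = 0 := by
    intro w
    have hw : w ∈ Submodule.span ℂ (Set.range b) := by
      rw [hb.span_eq_top_of_card_eq_finrank (by simp)]; trivial
    induction hw using Submodule.span_induction with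
    | mem x hx => obtain ⟨j, rfl⟩ := hx; exact hc j
    | zero => simp
    | add x y _ _ hx hy => simp [mul_add, Finset.sum_add_distrib, hx, hy]
    | smul c x _ hx =>
      simp only [Pi.smul_apply, smul_eq_mul, mul_left_comm _ c, ← Finset.mul_sum, hx, mul_zero]
  apply hi
  have := hspan (Pi.single i 1)
  simpa [Pi.single_apply] using this

/-- A change of the frame of the line, the third vector being kept, is a linear change of
coordinates for the residual curve. -/
theorem residual_eq_aeval {f : MvPolynomial (Fin 4) ℂ} {L : Submodule ℂ (Fin 4 → ℂ)}
    (hL : L ∈ linesOn f) {b c : Fin 3 → Fin 4 → ℂ} (hb : IsAdaptedFrame L b)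
    (hc : IsAdaptedFrame L c) {p u : Fin 3 → ℂ} (hp : c 0 = p 0 • b 0 + p 1 • b 1)
    (hu : c 1 = u 0 • b 0 + u 1 • b 1) (h2 : c 2 = b 2) :
    residual f c = MvPolynomial.aeval
      ![MvPolynomial.C (p 0) * MvPolynomial.X 0 + MvPolynomial.C (u 0) * MvPolynomial.X 1,
        MvPolynomial.C (p 1) * MvPolynomial.X 0 + MvPolynomial.C (u 1) * MvPolynomial.X 1,
        MvPolynomial.X 2] (residual f b) := by
  have h1 := planeSection_eq_X_mul_residual f L hL b hb
  have h3 := planeSection_eq_X_mul_residual f L hL c hc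
  refine mul_left_cancel₀ (MvPolynomial.X_ne_zero (2 : Fin 3)) ?_
  rw [← h3]
  have h4 := congrArg (MvPolynomial.aeval (R := ℂ)
      ![MvPolynomial.C (p 0) * MvPolynomial.X 0 + MvPolynomial.C (u 0) * MvPolynomial.X 1,
        MvPolynomial.C (p 1) * MvPolynomial.X 0 + MvPolynomial.C (u 1) * MvPolynomial.X 1,
        (MvPolynomial.X 2 : MvPolynomial (Fin 3) ℂ)]) h1
  rw [map_mul, MvPolynomial.aeval_X] at h4
  refine Eq.trans ?_ h4
  refine MvPolynomial.funext fun x => ?_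
  have e : ∀ g : MvPolynomial (Fin 3) ℂ, MvPolynomial.eval x (MvPolynomial.aeval
      ![MvPolynomial.C (p 0) * MvPolynomial.X 0 + MvPolynomial.C (u 0) * MvPolynomial.X 1,
        MvPolynomial.C (p 1) * MvPolynomial.X 0 + MvPolynomial.C (u 1) * MvPolynomial.X 1,
        (MvPolynomial.X 2 : MvPolynomial (Fin 3) ℂ)] g) = MvPolynomial.eval
      ![p 0 * x 0 + u 0 * x 1, p 1 * x 0 + u 1 * x 1, x 2] g := by
    intro g
    have e : (MvPolynomial.eval x).comp (MvPolynomial.aeval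
      ![MvPolynomial.C (p 0) * MvPolynomial.X 0 + MvPolynomial.C (u 0) * MvPolynomial.X 1,
        MvPolynomial.C (p 1) * MvPolynomial.X 0 + MvPolynomial.C (u 1) * MvPolynomial.X 1,
        (MvPolynomial.X 2 : MvPolynomial (Fin 3) ℂ)] :
          MvPolynomial (Fin 3) ℂ →ₐ[ℂ] MvPolynomial (Fin 3) ℂ).toRingHom = MvPolynomial.eval
        ![p 0 * x 0 + u 0 * x 1, p 1 * x 0 + u 1 * x 1, x 2] := by
      apply MvPolynomial.ringHom_ext
      · intro; simp
      · intro i; fin_cases i <;> simp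
    exact DFunLike.congr_fun e g
  rw [e, eval_planeSection, eval_planeSection]
  congr 2
  rw [Fin.sum_univ_three, Fin.sum_univ_three, hp, hu, h2]
  simp
  module

/-- Being an inflection does not depend on the frame of the line. -/
theorem IsInflection.of_aeval {g : MvPolynomial (Fin 3) ℂ} {p u : Fin 3 → ℂ} (hp2 : p 2 = 0)
    (hpu : p 0 * u 1 - p 1 * u 0 ≠ 0)
    (h : IsInflection (MvPolynomial.aeval
      ![MvPolynomial.C (p 0) * MvPolynomial.X 0 + MvPolynomial.C (u 0) * MvPolynomial.X 1,
        MvPolynomial.C (p 1) * MvPolynomial.X 0 + MvPolynomial.C (u 1) * MvPolynomial.X 1,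
        MvPolynomial.X 2] g) ![1, 0, 0]) (hp : MvPolynomial.eval p g = 0) :
    IsInflection g p := by
  obtain ⟨-, q, hq, hdvd⟩ := h
  refine ⟨hp, ![p 0 * q 0 + u 0 * q 1, p 1 * q 0 + u 1 * q 1, q 2], ?_, ?_⟩
  · rw [LinearIndependent.pair_iff] at hq ⊢
    intro s t hst
    have e0 := congrFun hst 0
    have e1 := congrFun hst 1
    have e2 := congrFun hst 2
    simp [hp2] at e0 e1 e2
    have i0 : s + t * q 0 = 0 := by
      refine (mul_eq_zero.1 ?_).resolve_left hpu
      linear_combination u 1 * e0 - u 0 * e1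
    have i1 : t * q 1 = 0 := by
      refine (mul_eq_zero.1 ?_).resolve_left hpu
      linear_combination p 0 * e1 - p 1 * e0
    refine hq s t ?_
    ext i
    fin_cases i
    · simpa using i0
    · simpa using i1
    · simpa using e2
  · have e : ((MvPolynomial.aeval
        (fun i => C ((![1, 0, 0] : Fin 3 → ℂ) i) + C (q i) * X)).comp (MvPolynomial.aeval
      ![MvPolynomial.C (p 0) * MvPolynomial.X 0 + MvPolynomial.C (u 0) * MvPolynomial.X 1,
        MvPolynomial.C (p 1) * MvPolynomial.X 0 + MvPolynomial.C (u 1) * MvPolynomial.X 1,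
        MvPolynomial.X 2]) : MvPolynomial (Fin 3) ℂ →ₐ[ℂ] ℂ[X]) =
        MvPolynomial.aeval (fun i => C (p i) + C ((![p 0 * q 0 + u 0 * q 1,
          p 1 * q 0 + u 1 * q 1, q 2] : Fin 3 → ℂ) i) * X) := by
      apply MvPolynomial.algHom_ext
      intro i
      fin_cases i
      · simp; ring
      · simp; ring
      · simp [hp2]
    have e' := DFunLike.congr_fun e g
    rw [← e']
    exact hdvd

/-! ### Counting the lines that meet a line -/

theorem exists_mem_forall_notMem {V ι : Type*} [AddCommGroup V] [Module ℂ V] [Finite ι]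
    (W : Submodule ℂ V) (N : ι → Submodule ℂ V) (h : ∀ i, ¬ W ≤ N i) :
    ∃ w ∈ W, ∀ i, w ∉ N i := by
  obtain ⟨x, hx⟩ := Submodule.exists_forall_notMem_of_forall_ne_top
    (fun i => (N i).comap W.subtype) (fun i hi => h i fun w hw => by
      have : (⟨w, hw⟩ : W) ∈ (N i).comap W.subtype := by rw [hi]; trivial
      exact this)
  exact ⟨x, x.2, hx⟩

theorem eq_span_pair {V : Type*} [AddCommGroup V] [Module ℂ V] {M : Submodule ℂ V}
    (hM : Module.finrank ℂ M = 2) {u v : V} (huv : LinearIndependent ℂ ![u, v]) (hu : u ∈ M)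
    (hv : v ∈ M) : Submodule.span ℂ {u, v} = M := by
  have : FiniteDimensional ℂ M := Module.finite_of_finrank_pos (by omega)
  refine Submodule.eq_of_le_of_finrank_eq ?_ ?_
  · rw [Submodule.span_le]
    rintro x (rfl | rfl)
    · exact hu
    · exact hv
  · rw [hM]
    have := finrank_span_eq_card huv
    rwa [Matrix.range_cons_cons_empty, Fintype.card_fin] at this

theorem finrank_span_singleton_le_one {V : Type*} [AddCommGroup V] [Module ℂ V] (x : V) :
    Module.finrank ℂ (Submodule.span ℂ {x}) ≤ 1 := by
  have h := finrank_span_le_card (R := ℂ) ({x} : Set V)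
  rwa [Set.toFinset_singleton, Finset.card_singleton] at h

theorem not_le_of_ne {V : Type*} [AddCommGroup V] [Module ℂ V] [FiniteDimensional ℂ V]
    {L M : Submodule ℂ V} (hL : Module.finrank ℂ L = 2) (hM : Module.finrank ℂ M = 2)
    (h : L ≠ M) : ¬ L ≤ M :=
  fun hle => h (Submodule.eq_of_le_of_finrank_eq hle (hL.trans hM.symm))

/-- A line that is not of the second kind has, by `isInflection_of_eval_flexPoly` at a point that
is not an inflection, a nonzero flex polynomial, in suitable coordinates in
which, moreover, the point at infinity of the line lies on no line of a given finite set. -/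
theorem exists_coord_flexPoly_ne_zero {f : MvPolynomial (Fin 4) ℂ} (hs : IsSmooth f)
    {L : Submodule ℂ (Fin 4 → ℂ)} (hL : L ∈ linesOn f) (hL2 : ¬ IsSecondKind f L)
    (A : Finset (Submodule ℂ (Fin 4 → ℂ)))
    (hA : ∀ M ∈ A, M ∈ linesOn f ∧ M ≠ L) :
    ∃ c : Fin 4 → Fin 4 → ℂ, LinearIndependent ℂ c ∧ Submodule.span ℂ {c 0, c 1} = L ∧
      (∀ M ∈ A, c 1 ∉ M) ∧ flexPoly (coordForm f c) ≠ 0 := by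
  unfold IsSecondKind at hL2
  push Not at hL2
  obtain ⟨b, hb, p, hp, hp2, hev, hni⟩ := hL2
  have hb0 : b 0 ∈ L := by rw [← hb.2]; exact Submodule.subset_span (by simp)
  have hb1 : b 1 ∈ L := by rw [← hb.2]; exact Submodule.subset_span (by simp)
  set P := p 0 • b 0 + p 1 • b 1 with hP
  have hPL : P ∈ L := L.add_mem (L.smul_mem _ hb0) (L.smul_mem _ hb1)
  obtain ⟨Q, hQL, hQ⟩ := exists_mem_forall_notMem (ι := Option A) L
    (fun o => o.elim (Submodule.span ℂ {P}) fun M => M) (by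
      rintro (_ | ⟨M, hM⟩)
      · intro h
        have h1 := Submodule.finrank_mono h
        rw [hL.1] at h1
        exact absurd (h1.trans (finrank_span_singleton_le_one P)) (by norm_num)
      · exact not_le_of_ne hL.1 (hA M hM).1.1 (hA M hM).2.symm)
  have hQP := hQ none
  have hQA : ∀ M ∈ A, Q ∉ M := fun M hM => hQ (some ⟨M, hM⟩)
  obtain ⟨u0, u1, hu⟩ : ∃ u0 u1 : ℂ, u0 • b 0 + u1 • b 1 = Q := by
    rw [← hb.2] at hQL; exact Submodule.mem_span_pair.1 hQL
  have hdet : p 0 * u1 - p 1 * u0 ≠ 0 := by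
    intro h
    refine hQP (Submodule.mem_span_singleton.2 ?_)
    by_cases h0 : p 0 = 0
    · have h1 : p 1 ≠ 0 := by
        intro h1
        exact hp (by ext i; fin_cases i <;> simp [h0, h1, hp2])
      have h2 : u0 = 0 := by simpa [h0, h1] using h
      refine ⟨u1 / p 1, ?_⟩
      rw [hP, ← hu, h0, h2]
      simp [smul_smul, h1]
    · refine ⟨u0 / p 0, ?_⟩
      rw [hP, ← hu, smul_add, smul_smul, smul_smul, div_mul_cancel₀ _ h0]
      congr 2
      field_simp
      linear_combination -h
  have hb3 := Fintype.linearIndependent_iff.1 hb.1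
  have hc3 : LinearIndependent ℂ ![P, Q, b 2] := by
    rw [Fintype.linearIndependent_iff]
    intro g hg
    rw [Fin.sum_univ_three] at hg
    simp only [Matrix.cons_val] at hg
    have h := hb3 ![g 0 * p 0 + g 1 * u0, g 0 * p 1 + g 1 * u1, g 2] (by
      rw [Fin.sum_univ_three, ← hg, hP, ← hu]
      simp only [Matrix.cons_val]
      module)
    have e0 := h 0
    have e1 := h 1
    have e2 := h 2
    simp only [Matrix.cons_val] at e0 e1 e2
    have i0 : g 0 = 0 := (mul_eq_zero.1 (by linear_combination u1 * e0 - u0 * e1 :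
      (p 0 * u1 - p 1 * u0) * g 0 = 0)).resolve_left hdet
    have i1 : g 1 = 0 := (mul_eq_zero.1 (by linear_combination p 0 * e1 - p 1 * e0 :
      (p 0 * u1 - p 1 * u0) * g 1 = 0)).resolve_left hdet
    intro i
    fin_cases i
    · exact i0
    · exact i1
    · exact e2
  have hPQ : LinearIndependent ℂ ![P, Q] := by
    rw [LinearIndependent.pair_iff]
    intro s t hst
    have h := Fintype.linearIndependent_iff.1 hc3 ![s, t, 0] (by
      rw [Fin.sum_univ_three]; simpa using hst)
    exact ⟨h 0, h 1⟩
  have hspan := eq_span_pair hL.1 hPQ hPL hQL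
  obtain ⟨e, he⟩ : ∃ e, e ∉ Submodule.span ℂ (Set.range ![P, Q, b 2]) := by
    by_contra! h
    have h1 := finrank_span_eq_card hc3
    rw [(Submodule.eq_top_iff').2 h, finrank_top] at h1
    simp at h1
  have hc : LinearIndependent ℂ ![P, Q, b 2, e] := by
    have h : ![P, Q, b 2, e] = Fin.snoc ![P, Q, b 2] e := by
      ext i j
      fin_cases i <;> rfl
    rw [h]
    exact hc3.finSnoc he
  refine ⟨![P, Q, b 2, e], hc, hspan, hQA, fun hΦ => hni ?_⟩
  set F := coordForm f ![P, Q, b 2, e] with hF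
  have hFL : ∀ x y : ℂ, MvPolynomial.eval ![x, y, 0, 0] F = 0 := by
    intro x y
    rw [hF, eval_coordForm]
    apply hL.2
    simp only [Fin.sum_univ_four, Matrix.cons_val, zero_smul, add_zero]
    exact L.add_mem (L.smul_mem _ hPL) (L.smul_mem _ hQL)
  have hcf : IsAdaptedFrame L ![P, Q, b 2] := ⟨hc3, hspan⟩
  have hres := residual_eq_aeval hL hb hcf (p := p) (u := ![u0, u1, 0]) hP hu.symm rfl
  refine IsInflection.of_aeval (u := ![u0, u1, 0]) hp2 (by simpa using hdet) ?_ hev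
  rw [← hres]
  refine isInflection_of_eval_flexPoly (F := F)
    (slice_ne_zero_of_isSmooth (isSmooth_coordForm hs hc) hFL 0) ?_ ?_ (by rw [hΦ, eval_zero])
  · rw [← planeSection_eq_X_mul_residual f L hL _ hcf]
    refine MvPolynomial.funext fun x => ?_
    have h : (MvPolynomial.eval x).comp (MvPolynomial.aeval
        ![MvPolynomial.X 0, MvPolynomial.X 1, MvPolynomial.X 2, 0] :
        MvPolynomial (Fin 4) ℂ →ₐ[ℂ] MvPolynomial (Fin 3) ℂ).toRingHom =
        MvPolynomial.eval ![x 0, x 1, x 2, 0] := by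
      apply MvPolynomial.ringHom_ext
      · intro; simp
      · intro i; fin_cases i <;> simp
    refine (DFunLike.congr_fun h F).trans ?_
    rw [hF, eval_coordForm, eval_planeSection, Fin.sum_univ_four, Fin.sum_univ_three]
    simp
  · have h : (MvPolynomial.eval ![1, 0, 0]).comp (MvPolynomial.aeval
        ![MvPolynomial.C (p 0) * MvPolynomial.X 0 + MvPolynomial.C u0 * MvPolynomial.X 1,
          MvPolynomial.C (p 1) * MvPolynomial.X 0 + MvPolynomial.C u1 * MvPolynomial.X 1,
          MvPolynomial.X 2] :
        MvPolynomial (Fin 3) ℂ →ₐ[ℂ] MvPolynomial (Fin 3) ℂ).toRingHom =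
        MvPolynomial.eval p := by
      apply MvPolynomial.ringHom_ext
      · intro; simp
      · intro i; fin_cases i <;> simp [hp2]
    rw [hres]
    exact (DFunLike.congr_fun h _).trans hev

/-- A line `M` of the surface that meets `L` lies in the tangent plane at the common point, and is
therefore spanned by this point and a vector with prescribed last two coordinates. -/
theorem exists_params_of_meets {f : MvPolynomial (Fin 4) ℂ} {L M : Submodule ℂ (Fin 4 → ℂ)}
    {c : Fin 4 → Fin 4 → ℂ} (hc : LinearIndependent ℂ c)
    (hcL : Submodule.span ℂ {c 0, c 1} = L) (h0 : slice (coordForm f c) 0 0 = 0)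
    (ht : ∀ t, (slice (coordForm f c) 1 0).eval t ≠ 0 ∨ (slice (coordForm f c) 0 1).eval t ≠ 0)
    (hL : Module.finrank ℂ L = 2) (hM : M ∈ linesOn f) (hML : M ≠ L) (hmeet : M ⊓ L ≠ ⊥)
    (h1 : c 1 ∉ M) :
    ∃ t a : ℂ, c 0 + t • c 1 ∈ M ∧ a • c 1 + -(slice (coordForm f c) 0 1).eval t • c 2
      + (slice (coordForm f c) 1 0).eval t • c 3 ∈ M := by
  obtain ⟨x, hx, hx0⟩ := Submodule.exists_mem_ne_zero_of_ne_bot hmeet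
  rw [Submodule.mem_inf, ← hcL, Submodule.mem_span_pair] at hx
  obtain ⟨hxM, a, b, rfl⟩ := hx
  have ha : a ≠ 0 := by
    rintro rfl
    rw [zero_smul, zero_add] at hxM hx0
    have hb : b ≠ 0 := fun h => hx0 (by rw [h, zero_smul])
    exact h1 ((M.smul_mem_iff hb).1 hxM)
  set t := b / a with ht'
  have hp : c 0 + t • c 1 ∈ M := by
    rw [← M.smul_mem_iff ha, smul_add, smul_smul, ht', mul_div_cancel₀ _ ha]
    exact hxM
  obtain ⟨v, hvM, hvL⟩ := SetLike.not_le_iff_exists.1 (not_le_of_ne hM.1 hL hML)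
  obtain ⟨w, rfl⟩ : ∃ w : Fin 4 → ℂ, ∑ i, w i • c i = v := by
    rw [← Submodule.mem_span_range_iff_exists_fun,
      hc.span_eq_top_of_card_eq_finrank (by simp)]
    trivial
  have hv' : (w 1 - w 0 * t) • c 1 + w 2 • c 2 + w 3 • c 3 ∈ M := by
    have := M.sub_mem hvM (M.smul_mem (w 0) hp)
    rw [Fin.sum_univ_four] at this
    convert this using 1
    module
  have hw : w 2 ≠ 0 ∨ w 3 ≠ 0 := by
    by_contra! h
    apply hvL
    rw [← hcL, Fin.sum_univ_four, h.1, h.2, Submodule.mem_span_pair]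
    exact ⟨w 0, w 1, by simp⟩
  have hlin : w 2 * (slice (coordForm f c) 1 0).eval t
      + w 3 * (slice (coordForm f c) 0 1).eval t = 0 := by
    rw [← coeff_one_aeval_line _ h0 (w 2) (w 3) t (w 1 - w 0 * t)]
    suffices h : (MvPolynomial.aeval ![1, C t + C (w 1 - w 0 * t) * X, C (w 2) * X, C (w 3) * X]
        (coordForm f c) : ℂ[X]) = 0 by rw [h, coeff_zero]
    refine Polynomial.funext fun s => ?_
    rw [eval_aeval_line, eval_coordForm, eval_zero]
    apply hM.2
    convert M.add_mem hp (M.smul_mem s hv') using 1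
    simp only [Fin.sum_univ_four, Matrix.cons_val]
    module
  obtain ⟨k, hk2, hk3⟩ : ∃ k : ℂ, w 2 = k * -(slice (coordForm f c) 0 1).eval t ∧
      w 3 = k * (slice (coordForm f c) 1 0).eval t := by
    rcases ht t with h | h
    · refine ⟨w 3 / (slice (coordForm f c) 1 0).eval t, ?_, ?_⟩
      · field_simp; linear_combination hlin
      · field_simp
    · refine ⟨-w 2 / (slice (coordForm f c) 0 1).eval t, ?_, ?_⟩
      · field_simp
      · field_simp; linear_combination hlin
  have hk : k ≠ 0 := by
    rintro rfl
    simp [hk2, hk3] at hw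
  refine ⟨t, (w 1 - w 0 * t) / k, hp, ?_⟩
  rw [← M.smul_mem_iff hk]
  convert hv' using 1
  rw [smul_add, smul_add, smul_smul, smul_smul, smul_smul, mul_div_cancel₀ _ hk, hk2, hk3]

/-- **Segre's bound**: a line that is not of the second kind meets at most `8 d - 14` other lines
of the surface. -/
theorem card_le_of_meets {d : ℕ} (hd : 3 ≤ d) {f : MvPolynomial (Fin 4) ℂ}
    (hf : f.IsHomogeneous d) (hs : IsSmooth f) {L : Submodule ℂ (Fin 4 → ℂ)}
    (hL : L ∈ linesOn f) (hL2 : ¬ IsSecondKind f L) (A : Finset (Submodule ℂ (Fin 4 → ℂ)))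
    (hA : ∀ M ∈ A, M ∈ linesOn f ∧ M ≠ L ∧ M ⊓ L ≠ ⊥) : A.card ≤ 8 * d - 14 := by
  classical
  obtain ⟨c, hc, hcL, hcA, hΦ⟩ := exists_coord_flexPoly_ne_zero hs hL hL2 A
    fun M hM => ⟨(hA M hM).1, (hA M hM).2.1⟩
  set F := coordForm f c with hF
  have hFL : ∀ x y : ℂ, MvPolynomial.eval ![x, y, 0, 0] F = 0 := by
    intro x y
    rw [hF, eval_coordForm]
    apply hL.2
    simp only [Fin.sum_univ_four, Matrix.cons_val, zero_smul, add_zero]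
    rw [← hcL, Submodule.mem_span_pair]
    exact ⟨x, y, rfl⟩
  have h0 := slice_zero_zero hFL
  have ht := slice_ne_zero_of_isSmooth (isSmooth_coordForm hs hc) hFL
  have hex : ∀ M, ∃ q : ℂ × ℂ, M ∈ A → c 0 + q.1 • c 1 ∈ M ∧
      q.2 • c 1 + -(slice F 0 1).eval q.1 • c 2 + (slice F 1 0).eval q.1 • c 3 ∈ M := by
    intro M
    by_cases hM : M ∈ A
    · obtain ⟨t, a, h1, h2⟩ := exists_params_of_meets hc hcL h0 ht hL.1 (hA M hM).1 (hA M hM).2.1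
        (hA M hM).2.2 (hcA M hM)
      exact ⟨(t, a), fun _ => ⟨h1, h2⟩⟩
    · exact ⟨0, fun h => absurd h hM⟩
  choose q hq using hex
  have hinj : Set.InjOn q A := by
    intro M hM N hN hMN
    have hM' := hq M hM
    have hN' := hq N hN
    rw [← hMN] at hN'
    have hli : LinearIndependent ℂ ![c 0 + (q M).1 • c 1, (q M).2 • c 1
        + -(slice F 0 1).eval (q M).1 • c 2 + (slice F 1 0).eval (q M).1 • c 3] := by
      rw [LinearIndependent.pair_iff]
      intro x y hxy
      have h := Fintype.linearIndependent_iff.1 hc ![x, x * (q M).1 + y * (q M).2,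
        y * -(slice F 0 1).eval (q M).1, y * (slice F 1 0).eval (q M).1] (by
          rw [← hxy, Fin.sum_univ_four]
          simp only [Matrix.cons_val]
          module)
      have e0 := h 0
      have e2 := h 2
      have e3 := h 3
      simp only [Matrix.cons_val] at e0 e2 e3
      refine ⟨e0, ?_⟩
      rcases ht (q M).1 with h | h
      · exact (mul_eq_zero.1 e3).resolve_right h
      · exact (mul_eq_zero.1 e2).resolve_right (neg_ne_zero.2 h)
    rw [← eq_span_pair (hA M hM).1.1 hli hM'.1 hM'.2, ← eq_span_pair (hA N hN).1.1 hli hN'.1 hN'.2]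
  -- the second parameters of the lines through the point `(1 : t : 0 : 0)`
  let Z : ℂ → Finset ℂ := fun t => {M ∈ A | (q M).1 = t}.image fun M => (q M).2
  have hZcard : ∀ t, (Z t).card = {M ∈ A | (q M).1 = t}.card := by
    intro t
    refine Finset.card_image_of_injOn fun M hM N hN hMN => ?_
    simp only [Finset.coe_filter, Set.mem_ofPred_eq] at hM hN
    exact hinj hM.1 hN.1 (Prod.ext (hM.2.trans hN.2.symm) hMN)
  have hZdvd : ∀ t, (X - C t) ^ (Z t).card ∣ flexPoly F := by
    intro t
    refine X_sub_C_pow_dvd_flexPoly h0 (ht t) fun a ha s => ?_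
    obtain ⟨M, hM, rfl⟩ := Finset.mem_image.1 ha
    obtain ⟨hMA, rfl⟩ := Finset.mem_filter.1 hM
    rw [hF, eval_coordForm]
    apply (hA M hMA).1.2
    convert M.add_mem (hq M hMA).1 (M.smul_mem s (hq M hMA).2) using 1
    simp only [Fin.sum_univ_four, Matrix.cons_val, hF]
    module
  have hdvd : ∏ t ∈ A.image (fun M => (q M).1), (X - C t) ^ (Z t).card ∣ flexPoly F := by
    refine Finset.prod_dvd_of_coprime (fun s _ t _ hst => ?_) fun t _ => hZdvd t
    exact (pairwise_coprime_X_sub_C Function.injective_id hst).pow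
  have hdeg := natDegree_le_of_dvd hdvd hΦ
  rw [natDegree_prod_of_monic _ _ fun t _ => (monic_X_sub_C t).pow _] at hdeg
  simp only [natDegree_pow, natDegree_X_sub_C, mul_one, hZcard] at hdeg
  rw [Finset.card_eq_sum_card_image (fun M => (q M).1) A]
  exact hdeg.trans (natDegree_flexPoly_le hd (isHomogeneous_coordForm hf c))

/-! ### The plane section -/

theorem eval_aeval_C_add_C_mul_X {σ : Type*} (f : MvPolynomial σ ℂ) (x y : σ → ℂ) (s : ℂ) :
    (MvPolynomial.aeval (fun i => C (x i) + C (y i) * X) f : ℂ[X]).eval s =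
      MvPolynomial.eval (x + s • y) f := by
  have e : (evalRingHom s).comp (MvPolynomial.aeval (fun i => C (x i) + C (y i) * X) :
      MvPolynomial σ ℂ →ₐ[ℂ] ℂ[X]).toRingHom = MvPolynomial.eval (x + s • y) := by
    apply MvPolynomial.ringHom_ext
    · intro; simp
    · intro; simp; ring
  exact DFunLike.congr_fun e f

theorem eval_smul_of_isHomogeneous {σ : Type*} {f : MvPolynomial σ ℂ} {d : ℕ}
    (hf : f.IsHomogeneous d) (s : ℂ) (x : σ → ℂ) :
    MvPolynomial.eval (s • x) f = s ^ d * MvPolynomial.eval x f := by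
  rw [MvPolynomial.eval_eq, MvPolynomial.eval_eq, Finset.mul_sum]
  refine Finset.sum_congr rfl fun m hm => ?_
  have h := hf (MvPolynomial.mem_support_iff.mp hm)
  rw [Finsupp.weight_apply, Finsupp.sum] at h
  simp only [Pi.one_apply, smul_eq_mul, mul_one] at h
  simp only [Pi.smul_apply, smul_eq_mul, mul_pow, Finset.prod_mul_distrib, Finset.prod_pow_eq_pow_sum,
    h]
  ring

/-- A form of degree `d` that vanishes at `x` and at `d` further points of the line `xy` vanishes at
`y`. -/
theorem eval_eq_zero_of_card {σ : Type*} {f : MvPolynomial σ ℂ} {d : ℕ} (hf : f.IsHomogeneous d)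
    {x y : σ → ℂ} (hx : MvPolynomial.eval x f = 0) (S : Finset ℂ) (hS : d ≤ S.card)
    (h : ∀ s ∈ S, MvPolynomial.eval (y + s • x) f = 0) : MvPolynomial.eval y f = 0 := by
  classical
  by_cases h0 : (0 : ℂ) ∈ S
  · simpa using h 0 h0
  -- in the chart centred at `x`, the points are `0` and the inverses of the elements of `S`
  have hz : (MvPolynomial.aeval (fun i => C (x i) + C (y i) * X) f : ℂ[X]) = 0 := by
    refine eq_zero_of_natDegree_lt_card_of_eval_eq_zero' _ (insert 0 (S.image (·⁻¹))) ?_ ?_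
    · intro r hr
      rw [eval_aeval_C_add_C_mul_X]
      rcases Finset.mem_insert.1 hr with rfl | hr
      · simpa using hx
      · obtain ⟨s, hs, rfl⟩ := Finset.mem_image.1 hr
        have hs0 : s ≠ 0 := fun h => h0 (h ▸ hs)
        have e : x + s⁻¹ • y = s⁻¹ • (y + s • x) := by
          rw [smul_add, smul_smul, inv_mul_cancel₀ hs0, one_smul, add_comm]
        rw [e, eval_smul_of_isHomogeneous hf, h s hs, mul_zero]
    · have h1 : (insert 0 (S.image (·⁻¹))).card = S.card + 1 := by
        rw [Finset.card_insert_of_notMem, Finset.card_image_of_injective _ inv_injective]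
        simpa using h0
      have h2 := MvPolynomial.aeval_natDegree_le (m := d) (n := 1) f hf.totalDegree_le
        (fun i => C (x i) + C (y i) * X) (fun i => by compute_degree)
      omega
  have hw : X * (MvPolynomial.aeval (fun i => C (y i) + C (x i) * X) f : ℂ[X]) = 0 := by
    refine Polynomial.funext fun s => ?_
    rw [eval_mul, eval_X, eval_aeval_C_add_C_mul_X, eval_zero]
    by_cases hs : s = 0
    · rw [hs, zero_mul]
    · have e : y + s • x = s • (x + s⁻¹ • y) := by
        rw [smul_add, smul_smul, mul_inv_cancel₀ hs, one_smul, add_comm]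
      rw [e, eval_smul_of_isHomogeneous hf, ← eval_aeval_C_add_C_mul_X, hz]
      simp
  have hw' := (mul_eq_zero.1 hw).resolve_left X_ne_zero
  have := eval_aeval_C_add_C_mul_X f y x 0
  rw [hw'] at this
  simpa using this.symm

/-- If the surface contains `d` lines of a plane, but not the whole plane, then these lines are its
plane section. -/
theorem exists_mem_of_mem_plane {d : ℕ} {f : MvPolynomial (Fin 4) ℂ} (hf : f.IsHomogeneous d)
    {H : Submodule ℂ (Fin 4 → ℂ)} (hH : Module.finrank ℂ H = 3)
    {T : Finset (Submodule ℂ (Fin 4 → ℂ))} (hcard : T.card = d)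
    (hT : ∀ L ∈ T, L ∈ linesOn f ∧ L ≤ H) (hne : ∃ y ∈ H, MvPolynomial.eval y f ≠ 0)
    {x : Fin 4 → ℂ} (hxH : x ∈ H) (hx : MvPolynomial.eval x f = 0) : ∃ L ∈ T, x ∈ L := by
  classical
  by_contra! hxT
  have hx1 := finrank_span_singleton_le_one x
  -- for `y` outside these proper subspaces, the lines of `T` cut the line `xy` in distinct points
  let N : T.offDiag → Submodule ℂ (Fin 4 → ℂ) := fun q => (q.1.1 ⊓ q.1.2) ⊔ Submodule.span ℂ {x}
  have hN : ∀ q, ¬ H ≤ N q := by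
    rintro ⟨⟨L, M⟩, hq⟩ hle
    obtain ⟨hL, hM, hLM⟩ := Finset.mem_offDiag.1 hq
    have hLM' : L ⊓ M < L := inf_le_left.lt_of_ne fun h =>
      not_le_of_ne (hT L hL).1.1 (hT M hM).1.1 hLM (inf_eq_left.1 h)
    have h1 := Submodule.finrank_lt_finrank_of_lt hLM'
    have h2 := Submodule.finrank_mono hle
    have h3 := Submodule.finrank_add_le_finrank_add_finrank (L ⊓ M) (Submodule.span ℂ {x})
    have h4 := (hT L hL).1.1
    simp only [N] at h2
    omega
  have hgen : ∀ y ∈ H, (∀ q, y ∉ N q) → MvPolynomial.eval y f = 0 := by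
    intro y hy hyN
    have hex : ∀ L : T, ∃ s : ℂ, y + s • x ∈ L.1 := by
      rintro ⟨L, hL⟩
      have hlt : L < L ⊔ Submodule.span ℂ {x} := by
        refine le_sup_left.lt_of_ne fun h => hxT L hL ?_
        rw [h]
        exact Submodule.mem_sup_right (Submodule.mem_span_singleton_self x)
      have h1 := Submodule.finrank_lt_finrank_of_lt hlt
      have hle : L ⊔ Submodule.span ℂ {x} ≤ H := by
        refine sup_le (hT L hL).2 ?_
        rwa [Submodule.span_singleton_le_iff_mem]
      have h2 := Submodule.finrank_mono hle
      have h4 := (hT L hL).1.1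
      rw [← Submodule.eq_of_le_of_finrank_eq hle (by omega), Submodule.mem_sup] at hy
      obtain ⟨a, ha, b, hb, rfl⟩ := hy
      obtain ⟨r, rfl⟩ := Submodule.mem_span_singleton.1 hb
      exact ⟨-r, by simpa using ha⟩
    choose s hs using hex
    have hinj : Function.Injective s := by
      intro L M hLM
      by_contra hne
      refine hyN ⟨(L.1, M.1), Finset.mem_offDiag.2 ⟨L.2, M.2, fun h => hne (Subtype.ext h)⟩⟩ ?_
      have hy' : y = (y + s L • x) + -(s L) • x := by module
      rw [hy']
      refine Submodule.add_mem_sup ⟨hs L, ?_⟩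
        (Submodule.smul_mem _ _ (Submodule.mem_span_singleton_self x))
      rw [hLM]; exact hs M
    refine eval_eq_zero_of_card hf hx (Finset.univ.image s) ?_ ?_
    · rw [Finset.card_image_of_injective _ hinj, Finset.card_univ, Fintype.card_coe, hcard]
    · intro r hr
      obtain ⟨L, -, rfl⟩ := Finset.mem_image.1 hr
      exact (hT L.1 L.2).1.2 _ (hs L)
  obtain ⟨y₀, hy₀, hy₀N⟩ := exists_mem_forall_notMem H N hN
  obtain ⟨y, hy, hyf⟩ := hne
  apply hyf
  have hz : (MvPolynomial.aeval (fun i => C (y i) + C (y₀ i) * X) f : ℂ[X]) = 0 := by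
    have hfin : (⋃ q, {s : ℂ | y + s • y₀ ∈ N q}).Finite := by
      refine Set.finite_iUnion fun q => Set.Subsingleton.finite fun s hs t ht => ?_
      by_contra hst
      have hst' : s - t ≠ 0 := sub_ne_zero.2 hst
      refine hy₀N q (((N q).smul_mem_iff hst').1 ?_)
      have : (y + s • y₀) - (y + t • y₀) = (s - t) • y₀ := by module
      rw [← this]
      exact (N q).sub_mem hs ht
    refine eq_zero_of_infinite_isRoot _ (hfin.infinite_compl.mono fun s hs => ?_)
    change eval s _ = 0
    rw [eval_aeval_C_add_C_mul_X]
    refine hgen _ (H.add_mem hy (H.smul_mem s hy₀)) fun q hq => hs ?_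
    exact Set.mem_iUnion.2 ⟨q, hq⟩
  have := eval_aeval_C_add_C_mul_X f y y₀ 0
  rw [hz] at this
  simpa using this.symm

theorem inf_ne_bot_of_finrank {V : Type*} [AddCommGroup V] [Module ℂ V] [FiniteDimensional ℂ V]
    {L M H : Submodule ℂ V} (hL : L ≤ H) (hM : M ≤ H)
    (h : Module.finrank ℂ H < Module.finrank ℂ L + Module.finrank ℂ M) : L ⊓ M ≠ ⊥ := by
  intro h0
  have h1 := Submodule.finrank_sup_add_finrank_inf_eq L M
  rw [h0, finrank_bot] at h1
  have h2 := Submodule.finrank_mono (sup_le hL hM)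
  omega

/-- By Segre's bound, a smooth surface cannot contain a plane through a line that is not of the
second kind. -/
theorem exists_mem_plane_eval_ne_zero {d : ℕ} (hd : 3 ≤ d) {f : MvPolynomial (Fin 4) ℂ}
    (hf : f.IsHomogeneous d) (hs : IsSmooth f) {H L : Submodule ℂ (Fin 4 → ℂ)}
    (hH : Module.finrank ℂ H = 3) (hLH : L ≤ H) (hL : L ∈ linesOn f) (hL2 : ¬ IsSecondKind f L) :
    ∃ y ∈ H, MvPolynomial.eval y f ≠ 0 := by
  classical
  by_contra! hHf
  obtain ⟨h, hhH, hhL⟩ := SetLike.not_le_iff_exists.1 (fun hle : H ≤ L => by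
    have h1 := Submodule.finrank_mono hle
    have h2 := hL.1
    omega)
  obtain ⟨p, hpL, hp⟩ := exists_mem_forall_notMem (ι := Unit) L (fun _ => ⊥) (fun _ hle => by
    have h1 := hL.1
    rw [le_bot_iff.1 hle, finrank_bot] at h1
    omega)
  obtain ⟨q, hqL, hq⟩ := exists_mem_forall_notMem (ι := Unit) L
    (fun _ => Submodule.span ℂ {p}) (fun _ hle => by
      have h1 := Submodule.finrank_mono hle
      rw [hL.1] at h1
      exact absurd (h1.trans (finrank_span_singleton_le_one p)) (by norm_num))
  replace hp : p ≠ 0 := hp ()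
  replace hq : q ∉ Submodule.span ℂ {p} := hq ()
  have hli : ∀ x y z : ℂ, x • p + y • q + z • h = 0 → x = 0 ∧ y = 0 ∧ z = 0 := by
    intro x y z hxyz
    have hz : z = 0 := by
      by_contra hz
      refine hhL ((L.smul_mem_iff hz).1 ?_)
      rw [← neg_eq_of_add_eq_zero_right hxyz]
      exact L.neg_mem (L.add_mem (L.smul_mem _ hpL) (L.smul_mem _ hqL))
    rw [hz, zero_smul, add_zero] at hxyz
    have hy : y = 0 := by
      by_contra hy
      refine hq (((Submodule.span ℂ {p}).smul_mem_iff hy).1 ?_)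
      rw [← neg_eq_of_add_eq_zero_right hxyz]
      exact Submodule.neg_mem _ (Submodule.smul_mem _ _ (Submodule.mem_span_singleton_self p))
    rw [hy, zero_smul, add_zero] at hxyz
    exact ⟨(smul_eq_zero.1 hxyz).resolve_right hp, hy, hz⟩
  -- infinitely many lines through `p` in the plane `H`
  let M : ℕ → Submodule ℂ (Fin 4 → ℂ) := fun n => Submodule.span ℂ {p, q + ((n : ℂ) + 1) • h}
  have hMli : ∀ n : ℕ, LinearIndependent ℂ ![p, q + ((n : ℂ) + 1) • h] := by
    intro n
    rw [LinearIndependent.pair_iff]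
    intro s t hst
    have := hli s t (t * (n + 1)) (by rw [← hst]; module)
    exact ⟨this.1, this.2.1⟩
  have hM2 : ∀ n, Module.finrank ℂ (M n) = 2 := by
    intro n
    have := finrank_span_eq_card (hMli n)
    rwa [Matrix.range_cons_cons_empty, Fintype.card_fin] at this
  have hMH : ∀ n, M n ≤ H := by
    intro n
    rw [Submodule.span_le]
    rintro x (rfl | rfl)
    · exact hLH hpL
    · exact H.add_mem (hLH hqL) (H.smul_mem _ hhH)
  have hmem : ∀ n : ℕ, ∀ z : ℂ, q + z • h ∈ M n → z = n + 1 := by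
    intro n z hz
    obtain ⟨a, b, hab⟩ := Submodule.mem_span_pair.1 hz
    have := hli a (b - 1) (b * (n + 1) - z) (by
      have : a • p + b • (q + ((n : ℂ) + 1) • h) - (q + z • h) = 0 := by rw [hab, sub_self]
      rw [← this]; module)
    linear_combination (n + 1 : ℂ) * this.2.1 - this.2.2
  have hinj : Function.Injective M := by
    intro m n hmn
    have h1 : q + ((m : ℂ) + 1) • h ∈ M n := by
      rw [← hmn]; exact Submodule.subset_span (by simp)
    have := hmem n _ h1
    exact_mod_cast add_right_cancel this
  have hcount := card_le_of_meets hd hf hs hL hL2 ((Finset.range (8 * d)).image M) (by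
    intro K hK
    obtain ⟨n, -, rfl⟩ := Finset.mem_image.1 hK
    refine ⟨⟨hM2 n, fun v hv => hHf v (hMH n hv)⟩, fun hML => ?_, ?_⟩
    · have h0 := hmem n 0 (by rw [hML]; simpa using hqL)
      have h1 : ((n + 1 : ℕ) : ℂ) = 0 := by push_cast; exact h0.symm
      exact Nat.succ_ne_zero n (Nat.cast_eq_zero.1 h1)
    · exact inf_ne_bot_of_finrank (hMH n) hLH (by rw [hM2, hL.1, hH]; norm_num))
  rw [Finset.card_image_of_injective _ hinj, Finset.card_range] at hcount
  omega

end SurfaceLines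

theorem mainTheorem6 (d : ℕ) (hd : 3 ≤ d) (f : MvPolynomial (Fin 4) ℂ) (hf : f.IsHomogeneous d)
    (hsmooth : SurfaceLines.IsSmooth f)
    (H : Submodule ℂ (Fin 4 → ℂ)) (hH : Module.finrank ℂ H = 3)
    (T : Finset (Submodule ℂ (Fin 4 → ℂ))) (hcard : T.card = d)
    (hT : ∀ C ∈ T, C ∈ SurfaceLines.linesOn f ∧ C ≤ H ∧ ¬ SurfaceLines.IsSecondKind f C) :
    (SurfaceLines.linesOn f).Finite ∧ (SurfaceLines.linesOn f).ncard ≤ d * (7 * d - 12) := by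
  classical
  open SurfaceLines in
  obtain ⟨C₀, hC₀⟩ : T.Nonempty := Finset.card_pos.1 (by omega)
  have hne := exists_mem_plane_eval_ne_zero hd hf hsmooth hH (hT C₀ hC₀).2.1 (hT C₀ hC₀).1
    (hT C₀ hC₀).2.2
  have hsec : ∀ x ∈ H, MvPolynomial.eval x f = 0 → ∃ L ∈ T, x ∈ L := fun x hxH hx =>
    exists_mem_of_mem_plane hf hH hcard (fun L hL => ⟨(hT L hL).1, (hT L hL).2.1⟩) hne hxH hx
  let A : Submodule ℂ (Fin 4 → ℂ) → Set (Submodule ℂ (Fin 4 → ℂ)) :=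
    fun C => {M | M ∈ linesOn f ∧ M ≠ C ∧ M ⊓ C ≠ ⊥}
  have hAfin : ∀ C ∈ T, (A C).Finite := by
    intro C hC
    by_contra hinf
    obtain ⟨B, hB, hBcard⟩ := Set.Infinite.exists_subset_card_eq hinf (8 * d)
    have := card_le_of_meets hd hf hsmooth (hT C hC).1 (hT C hC).2.2 B fun M hM => hB hM
    omega
  let B : T → Finset (Submodule ℂ (Fin 4 → ℂ)) := fun C => (hAfin C.1 C.2).toFinset \ T
  -- of the at most `8 d - 14` lines that meet `C`, the other `d - 1` lines of `T` are discarded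
  have hB : ∀ C, (B C).card ≤ 7 * d - 13 := by
    rintro ⟨C, hC⟩
    have h1 : (hAfin C hC).toFinset.card ≤ 8 * d - 14 :=
      card_le_of_meets hd hf hsmooth (hT C hC).1 (hT C hC).2.2 _ fun M hM =>
      (Set.Finite.mem_toFinset (hAfin C hC)).1 hM
    have h2 : T.erase C ⊆ (hAfin C hC).toFinset ∩ T := by
      intro M hM
      obtain ⟨hMC, hMT⟩ := Finset.mem_erase.1 hM
      refine Finset.mem_inter.2 ⟨(Set.Finite.mem_toFinset _).2 ⟨(hT M hMT).1, hMC, ?_⟩, hMT⟩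
      refine inf_ne_bot_of_finrank (hT M hMT).2.1 (hT C hC).2.1 ?_
      rw [(hT M hMT).1.1, (hT C hC).1.1, hH]
      norm_num
    have h3 := Finset.card_le_card h2
    rw [Finset.card_erase_of_mem hC, hcard] at h3
    have h4 := Finset.card_sdiff_add_card_inter (hAfin C hC).toFinset T
    simp only [B]
    omega
  have hsub : linesOn f ⊆ ((T ∪ Finset.univ.biUnion B : Finset _) : Set _) := by
    intro L hL
    rw [Finset.mem_coe, Finset.mem_union]
    by_cases hLT : L ∈ T
    · exact Or.inl hLT
    right
    by_cases hLH : L ≤ H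
    · exfalso
      obtain ⟨w, hwL, hw⟩ := exists_mem_forall_notMem L (fun M : T => M.1) fun M =>
        not_le_of_ne hL.1 (hT M.1 M.2).1.1 fun h => hLT (h ▸ M.2)
      obtain ⟨M, hM, hwM⟩ := hsec w (hLH hwL) (hL.2 w hwL)
      exact hw ⟨M, hM⟩ hwM
    · have hinf : L ⊓ H ≠ ⊥ := inf_ne_bot_of_finrank (H := ⊤) le_top le_top (by
        rw [hL.1, hH, finrank_top]; simp)
      obtain ⟨x, hx, hx0⟩ := Submodule.exists_mem_ne_zero_of_ne_bot hinf
      obtain ⟨C, hC, hxC⟩ := hsec x hx.2 (hL.2 x hx.1)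
      refine Finset.mem_biUnion.2 ⟨⟨C, hC⟩, Finset.mem_univ _, Finset.mem_sdiff.2 ⟨?_, hLT⟩⟩
      refine (Set.Finite.mem_toFinset _).2 ⟨hL, fun h => hLH (h ▸ (hT C hC).2.1), fun h => hx0 ?_⟩
      rw [← Submodule.mem_bot ℂ, ← h]
      exact ⟨hx.1, hxC⟩
  refine ⟨(Finset.finite_toSet _).subset hsub, ?_⟩
  have h1 := Set.ncard_le_ncard hsub (Finset.finite_toSet _)
  rw [Set.ncard_coe_finset] at h1
  have h2 := Finset.card_union_le T (Finset.univ.biUnion B)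
  have h3 := Finset.card_biUnion_le_card_mul Finset.univ B (7 * d - 13) fun C _ => hB C
  rw [Finset.card_univ, Fintype.card_coe, hcard] at h3
  have h4 : d * (7 * d - 12) = d + d * (7 * d - 13) := by
    rw [show 7 * d - 12 = 1 + (7 * d - 13) by omega]; ring
  omega
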